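/- Let $\{P_\theta\}_{\theta\in\Theta}$, $\Theta\subseteq\mathbb{R}^d$, be a family of probability measures on a measurable space $\mathcal X$ with densities $p_\theta=\mathrm{d}P_\theta/\mathrm{d}\mu$ with respect to a $\sigma$-finite measure $\mu$, and let $\theta\in\Theta$ be a point at which derivatives along $\Theta$ are unique (for instance an interior point). Gradients below are taken in $\theta$, along $\Theta$. Assume that Fisher information is defined at $\theta$ in the usual sense, namely that the family is regular at $\theta$: the gradient $\nabla p_\theta(x)$ exists for $P_\theta$-almost every $x$, the score $\nabla\log p_\theta=\nabla p_\theta/p_\theta$ is $P_\theta$-integrable, and $$\int\big|p_{\theta'}-p_\theta-p_\theta\langle\nabla\log p_\theta,\theta'-\theta\rangle\big|\,\mathrm{d}\mu=o(\|\theta'-\theta\|)\qquad(\theta'\to\theta,\ \theta'\in\Theta).$$ For $u\in\mathbb{R}^d$ write $u^{\mathsf T}I_X(\theta)u=\mathbb{E}_{P_\theta}[\langle u,\nabla\log p_\theta(X)\rangle^2]\in[0,\infty]$; if the score is square integrable, this is the quadratic form of the Fisher information matrix $I_X(\theta)=\mathbb{E}_{P_\theta}[\nabla\log p_\theta(X)\,\nabla\log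 p_\theta(X)^{\mathsf T}]$. No further condition is imposed on the family; in particular the score need not be square integrable. Let $\varepsilon\ge0$ and $n\ge 0$. Let $X_1,\dots,X_n$ be i.i.d. with law $P_\theta$ and let $Z^n=(Z_1,\dots,Z_n)$ be generated sequentially: given $X^n$ and $Z^{i-1}=z^{i-1}$, the output $Z_i$ is drawn from $\mathsf K_i(\cdot\mid X_i,z^{i-1})$, where the $\mathsf K_i$ are Markov kernels such that for every $i$ and every $z^{i-1}$ the mechanism $\mathsf K_i(\cdot\mid\cdot,z^{i-1})$ is $\varepsilon$-LDP, i.e. $\mathsf K_i(A\mid x,z^{i-1})\le e^{\varepsilon}\mathsf K_i(A\mid x',z^{i-1})$ for all measurable $A$ and all $x,x'\in\mathcal X$. Put $\Upsilon_\varepsilon=\big[\frac{e^\varepsilon-1}{e^\varepsilon+1}\big]^2$. Then the laws of $Z^n$ have densities $q_{\theta'}$, $\theta'\in\Theta$, with respect to some $\sigma$-finite measure whose gradient at $\theta$ exists almost surely under the law of $Z^n$ at $\theta$. For every such choice of densities (with respect to any $\sigma$-finite measure), the family of laws of $Z^n$ is regular at $\theta$, and with $I_{Z^n}(\theta)$ computed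 from the score $\nabla\log q_\theta$, $$u^{\mathsf T}I_{Z^n}(\theta)u\le n\Upsilon_\varepsilon\,u^{\mathsf T}I_X(\theta)u\quad\text{in }[0,\infty]\text{ for all }u\in\mathbb{R}^d$$ (with the convention $0\cdot\infty=0$). In particular, if the score of $P_\theta$ is square integrable, then so is that of $Z^n$, and the Fisher information matrices satisfy $I_{Z^n}(\theta)\preccurlyeq n\Upsilon_\varepsilon I_X(\theta)$ in the Loewner order. -/

import Mathlib

open MeasureTheory ProbabilityTheory Filter Topology Asymptotics
open scoped ENNReal RealInnerProductSpace

noncomputable section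

namespace LDPFisher

/-! ### Locally private mechanisms and their sequential composition -/

/-- A mechanism `κ : 𝒳 → 𝒫(𝒵)` is `ε`-locally differentially private if
`κ(A|x) ≤ e^ε κ(A|x')` for all events `A` and all inputs `x, x'`. -/
def IsLDP {X Z : Type*} [MeasurableSpace X] [MeasurableSpace Z] (ε : ℝ) (κ : Kernel X Z) : Prop :=
  ∀ (x x' : X) (A : Set Z), MeasurableSet A →
    κ x A ≤ ENNReal.ofReal (Real.exp ε) * κ x' A

/-- Appending the last output to the previous ones, `(z^{n}, w) ↦ (z_1, …, z_n, w)`. -/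
def snocOutput (Z : Type*) (n : ℕ) (y : (Fin n → Z) × Z) : Fin (n + 1) → Z :=
  Fin.snoc (α := fun _ => Z) y.1 y.2

lemma measurable_snocOutput (Z : Type*) [MeasurableSpace Z] (n : ℕ) :
    Measurable (snocOutput Z n) := by
  refine measurable_pi_iff.mpr fun i => ?_
  refine Fin.lastCases ?_ (fun j => ?_) i
  · simpa [snocOutput] using measurable_snd
  · have h : Measurable fun y : (Fin n → Z) × Z => y.1 j :=
      (measurable_pi_apply j).comp measurable_fst
    simpa [snocOutput] using h

/-- The channel `K^n : 𝒳^n → 𝒫(𝒵^n)` obtained by running `K_1, …, K_n` sequentially: given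
`X^n = x^n` and the previous outputs `Z^{i-1} = z^{i-1}`, the output `Z_i` is drawn from
`K_i(· | x_i, z^{i-1})`. -/
def seqChannel {X Z : Type*} [MeasurableSpace X] [MeasurableSpace Z] :
    (n : ℕ) → ((i : Fin n) → Kernel (X × (Fin i → Z)) Z) → Kernel (Fin n → X) (Fin n → Z)
  | 0, _ => Kernel.const _ (Measure.dirac Fin.elim0)
  | n + 1, K =>
      (((seqChannel n fun i => K i.castSucc).comap (fun x : Fin (n + 1) → X => fun j => x j.castSucc)
          (measurable_pi_lambda _ fun j => measurable_pi_apply j.castSucc)) ⊗ₖ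
        ((K (Fin.last n)).comap
          (fun y : (Fin (n + 1) → X) × (Fin n → Z) => (y.1 (Fin.last n), y.2))
          (((measurable_pi_apply (Fin.last n)).comp measurable_fst).prodMk measurable_snd))).map
        (snocOutput Z n)

instance isMarkovKernel_seqChannel {X Z : Type*} [MeasurableSpace X] [MeasurableSpace Z] :
    ∀ (n : ℕ) (K : (i : Fin n) → Kernel (X × (Fin i → Z)) Z) [∀ i, IsMarkovKernel (K i)],
      IsMarkovKernel (seqChannel n K)
  | 0, _, _ => by unfold seqChannel; infer_instance
  | n + 1, K, hK => by
      have h1 : IsMarkovKernel (seqChannel n fun i => K i.castSucc) :=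
        @isMarkovKernel_seqChannel _ _ _ _ n _ (fun i => hK i.castSucc)
      have h2 : IsMarkovKernel (K (Fin.last n)) := hK _
      unfold seqChannel
      exact Kernel.IsMarkovKernel.map _ (measurable_snocOutput Z n)

/-- The law of `Z^n` when `X_1, …, X_n` are i.i.d. with law `P`: the output law `P^{⊗n} K^n`. -/
def outputLaw {X Z : Type*} [MeasurableSpace X] [MeasurableSpace Z] {n : ℕ}
    (K : (i : Fin n) → Kernel (X × (Fin i → Z)) Z) (P : Measure X) : Measure (Fin n → Z) :=
  (Measure.pi fun _ : Fin n => P).bind (seqChannel n K)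

/-- The constant `Υ_ε = [(e^ε - 1) / (e^ε + 1)]²`. -/
def Upsilon (ε : ℝ) : ℝ := ((Real.exp ε - 1) / (Real.exp ε + 1)) ^ 2

/-! ### Fisher information of a parametric family -/

section Fisher

variable {X : Type*} [MeasurableSpace X] {d : ℕ}

/-- `p θ` is a density of `P θ` with respect to `μ`, for every parameter `θ ∈ Θ`. -/
structure IsDensityFamily (Θ : Set (EuclideanSpace ℝ (Fin d)))
    (P : EuclideanSpace ℝ (Fin d) → Measure X) (μ : Measure X)
    (p : EuclideanSpace ℝ (Fin d) → X → ℝ) : Prop where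
  measurable : ∀ θ ∈ Θ, Measurable (p θ)
  nonneg : ∀ θ ∈ Θ, ∀ x, 0 ≤ p θ x
  withDensity_eq : ∀ θ ∈ Θ, P θ = μ.withDensity fun x => ENNReal.ofReal (p θ x)

/-- The score `∇ log p_θ(x)`, the gradient being taken in the parameter. -/
def score (Θ : Set (EuclideanSpace ℝ (Fin d))) (p : EuclideanSpace ℝ (Fin d) → X → ℝ)
    (θ : EuclideanSpace ℝ (Fin d)) (x : X) : EuclideanSpace ℝ (Fin d) :=
  gradientWithin (fun θ' => Real.log (p θ' x)) Θ θ

/-- The gradient `∇ p_θ(x)`, hence `∇ log p_θ(x)`, exists for `P_θ`-almost every `x`. -/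
def HasScoreAt (Θ : Set (EuclideanSpace ℝ (Fin d)))
    (P : EuclideanSpace ℝ (Fin d) → Measure X) (p : EuclideanSpace ℝ (Fin d) → X → ℝ)
    (θ : EuclideanSpace ℝ (Fin d)) : Prop :=
  ∀ᵐ x ∂(P θ), DifferentiableWithinAt ℝ (fun θ' => p θ' x) Θ θ

/-- The family is regular at `θ`: the score exists almost surely and is integrable, and the
pointwise derivative `p_θ ∇ log p_θ` of the density is also its derivative in `L¹(μ)`, i.e.
`∫ |p_θ' - p_θ - p_θ ⟨∇ log p_θ, θ' - θ⟩| dμ = o(‖θ' - θ‖)`.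

This is the usual requirement that differentiation in `θ` may be interchanged with integration.
Square integrability of the score is not required. -/
structure IsRegularAt (Θ : Set (EuclideanSpace ℝ (Fin d)))
    (P : EuclideanSpace ℝ (Fin d) → Measure X) (μ : Measure X)
    (p : EuclideanSpace ℝ (Fin d) → X → ℝ) (θ : EuclideanSpace ℝ (Fin d)) : Prop where
  hasScoreAt : HasScoreAt Θ P p θ
  integrable_score : Integrable (score Θ p θ) (P θ)
  isLittleO : (fun θ' => ∫ x, |p θ' x - p θ x - p θ x * ⟪score Θ p θ x, θ' - θ⟫| ∂μ)
    =o[𝓝[Θ] θ] fun θ' => θ' - θ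

/-- The Fisher information matrix `I(θ) = 𝔼_θ[∇ log p_θ (∇ log p_θ)ᵀ]`. It is meaningful when the
score is square integrable. -/
def fisherMatrix (Θ : Set (EuclideanSpace ℝ (Fin d)))
    (P : EuclideanSpace ℝ (Fin d) → Measure X) (p : EuclideanSpace ℝ (Fin d) → X → ℝ)
    (θ : EuclideanSpace ℝ (Fin d)) : Matrix (Fin d) (Fin d) ℝ :=
  Matrix.of fun i j => ∫ x, score Θ p θ x i * score Θ p θ x j ∂(P θ)

/-- The quadratic form `uᵀ I(θ) u = 𝔼_θ[⟨u, ∇ log p_θ⟩²]` of the Fisher information, with values in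
`[0, ∞]`, so that it is meaningful also when the Fisher information is infinite. -/
def fisherForm (Θ : Set (EuclideanSpace ℝ (Fin d)))
    (P : EuclideanSpace ℝ (Fin d) → Measure X) (p : EuclideanSpace ℝ (Fin d) → X → ℝ)
    (θ u : EuclideanSpace ℝ (Fin d)) : ℝ≥0∞ :=
  ∫⁻ x, ENNReal.ofReal (⟪u, score Θ p θ x⟫ ^ 2) ∂(P θ)

end Fisher

end LDPFisher

end

/-! Privacy makes all conditional output laws comparable, and this is used twice.

Contraction. If `L = e^ε` and `k, k'` are the output probabilities of two inputs, the ratio bound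
gives `k k' ≥ L/(1+L)² (k+k')²`. By Cauchy–Schwarz the overlap `∑ k k'/q` relative to the mean
output law `q` is then at least `4L/(1+L)² = 1 - Υ_ε`. Integrating this against `(g x - g y)²` for
two independent inputs shows that conditional expectation given the output shrinks the second moment
of a centred bounded `g` by `Υ_ε` (`sum_sq_condMean_le`). By duality the same constant bounds the
variance of a mean response (`IsLDP.variance_le`), and a second duality covers scores that are
merely integrable (`IsLDP.lintegral_sq_posterior_mean_le`).

Smoothing. Each `κ x` is at most `e^ε` times the output law, so a signed input density `h` is sent
to an output measure with density bounded by `e^ε ‖h‖₁`. An `L¹` expansion of the input densities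
thus becomes a uniform expansion of the output densities relative to the law at `θ`, with bounded
score `𝔼[score | output]` (`IsLDP.hasUniformScore`). Uniform expansions survive products, whereas
`L¹` expansions alone need not.

Rounds are added by induction. The last sample is independent of the past outputs, so publishing the
past `W`, with law frozen at `θ`, together with the new output is again a private channel in that
sample. The new score is `s(W) + t`; the cross term vanishes because the input score is centred and
independent of `W`, so each round adds at most `Υ_ε I_X(θ)` (`HasUniformScore.const_compProd`).
Finally, any other choice of densities has almost surely the same score
(`HasUniformScore.score_ae_eq`). -/

namespace LDPFisher

/-! ### Contraction of the variance under a locally private mechanism -/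

section Contraction

variable {X : Type*} [MeasurableSpace X]

lemma integrable_of_abs_le {P : Measure X} [IsFiniteMeasure P] {f : X → ℝ} (hf : Measurable f)
    {C : ℝ} (hC : ∀ x, |f x| ≤ C) : Integrable f P :=
  Integrable.of_bound hf.aestronglyMeasurable C (ae_of_all _ hC)

lemma integrable_linear_comb {P : Measure X} {f g h : X → ℝ} (hf : Integrable f P)
    (hg : Integrable g P) (hh : Integrable h P) (a b c : ℝ) :
    Integrable (fun x => a * f x + b * g x + c * h x) P :=
  ((hf.const_mul a).add (hg.const_mul b)).add (hh.const_mul c)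

lemma integral_linear_comb {P : Measure X} {f g h : X → ℝ} (hf : Integrable f P)
    (hg : Integrable g P) (hh : Integrable h P) (a b c : ℝ) :
    ∫ x, (a * f x + b * g x + c * h x) ∂P = a * ∫ x, f x ∂P + b * ∫ x, g x ∂P + c * ∫ x, h x ∂P := by
  have h1 : Integrable (fun x => a * f x + b * g x) P := (hf.const_mul a).add (hg.const_mul b)
  rw [integral_add h1 (hh.const_mul c), integral_add (hf.const_mul a) (hg.const_mul b),
    integral_const_mul, integral_const_mul, integral_const_mul]

lemma one_sub_Upsilon (ε : ℝ) :
    1 - Upsilon ε = 4 * (Real.exp ε / (1 + Real.exp ε) ^ 2) := by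
  have := Real.exp_pos ε
  unfold Upsilon
  field_simp
  ring

lemma Upsilon_nonneg (ε : ℝ) : 0 ≤ Upsilon ε := sq_nonneg _

/-- The identity behind it is `(1+L)² ab - L(a+b)² = (Lb - a)(La - b)`. -/
lemma mul_ge_of_le_mul {L a b : ℝ} (hL : 0 < L) (hab : a ≤ L * b) (hba : b ≤ L * a) :
    L / (1 + L) ^ 2 * (a + b) ^ 2 ≤ a * b := by
  rw [div_mul_eq_mul_div, div_le_iff₀ (by positivity)]
  nlinarith [mul_nonneg (sub_nonneg.2 hab) (sub_nonneg.2 hba)]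

/-- The overlap `∑ⱼ kⱼ kⱼ' / qⱼ` of two probability vectors whose coordinates differ by a factor of
at most `e^ε` is at least `1 - Υ_ε`. -/
lemma one_sub_Upsilon_le_overlap {ι : Type*} (s : Finset ι) {ε : ℝ} {k k' q : ι → ℝ}
    (hq : ∀ j ∈ s, 0 ≤ q j) (hkq : ∀ j ∈ s, q j = 0 → k j = 0 ∧ k' j = 0)
    (h : ∀ j ∈ s, k j ≤ Real.exp ε * k' j) (h' : ∀ j ∈ s, k' j ≤ Real.exp ε * k j)
    (hk : ∑ j ∈ s, k j = 1) (hk' : ∑ j ∈ s, k' j = 1) (hq1 : ∑ j ∈ s, q j = 1) :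
    1 - Upsilon ε ≤ ∑ j ∈ s, (q j)⁻¹ * (k j * k' j) := by
  set m := Real.exp ε / (1 + Real.exp ε) ^ 2 with hm
  have hm0 : 0 ≤ m := by positivity
  -- Cauchy–Schwarz with weights `q`; since `k` and `k'` each have mass one, the left side equals
  -- `4`.
  have h1 : (∑ j ∈ s, (k j + k' j)) ^ 2 ≤ (∑ j ∈ s, (q j)⁻¹ * (k j + k' j) ^ 2) * ∑ j ∈ s, q j := by
    refine Finset.sum_sq_le_sum_mul_sum_of_sq_le_mul s
      (fun j hj => mul_nonneg (inv_nonneg.2 (hq j hj)) (sq_nonneg _)) hq fun j hj => ?_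
    by_cases h0 : q j = 0
    · simp [h0, hkq j hj h0]
    · field_simp; rfl
  rw [Finset.sum_add_distrib, hk, hk', hq1, mul_one] at h1
  calc 1 - Upsilon ε = m * (1 + 1) ^ 2 := by rw [one_sub_Upsilon, ← hm]; ring
    _ ≤ m * ∑ j ∈ s, (q j)⁻¹ * (k j + k' j) ^ 2 := mul_le_mul_of_nonneg_left h1 hm0
    _ = ∑ j ∈ s, (q j)⁻¹ * (m * (k j + k' j) ^ 2) := by
      rw [Finset.mul_sum]; exact Finset.sum_congr rfl fun j _ => by ring
    _ ≤ _ := Finset.sum_le_sum fun j hj => mul_le_mul_of_nonneg_left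
      (mul_ge_of_le_mul (Real.exp_pos ε) (h j hj) (h' j hj)) (inv_nonneg.2 (hq j hj))

variable {P : Measure X} [IsProbabilityMeasure P]

/-- The `χ²`-contraction of a locally private channel with finitely many outputs: for a bounded
centred `g`, the conditional means `tⱼ / qⱼ` of `g` satisfy `∑ⱼ tⱼ² / qⱼ ≤ Υ_ε ∫ g² dP`. -/
lemma sum_sq_condMean_le {ι : Type*} (s : Finset ι) {ε : ℝ} {k : ι → X → ℝ}
    (hkm : ∀ j, Measurable (k j)) (hk0 : ∀ j x, 0 ≤ k j x) (hk1 : ∀ j x, k j x ≤ 1)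
    (hsum : ∀ x, ∑ j ∈ s, k j x = 1) (hL : ∀ j x y, k j x ≤ Real.exp ε * k j y)
    {g : X → ℝ} (hgm : Measurable g) {C : ℝ} (hgC : ∀ x, |g x| ≤ C) (hg0 : ∫ x, g x ∂P = 0) :
    ∑ j ∈ s, (∫ x, k j x ∂P)⁻¹ * (∫ x, g x * k j x ∂P) ^ 2 ≤ Upsilon ε * ∫ x, g x ^ 2 ∂P := by
  set q : ι → ℝ := fun j => ∫ x, k j x ∂P with hq
  set t : ι → ℝ := fun j => ∫ x, g x * k j x ∂P with ht
  set G : ι → ℝ := fun j => ∫ x, g x ^ 2 * k j x ∂P with hG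
  set V := ∫ x, g x ^ 2 ∂P with hV
  have hkabs : ∀ j x, |k j x| ≤ 1 := fun j x => by rw [abs_of_nonneg (hk0 j x)]; exact hk1 j x
  have hg2 : ∀ x, |g x ^ 2| ≤ C ^ 2 := fun x => by
    rw [abs_pow]; exact pow_le_pow_left₀ (abs_nonneg _) (hgC x) 2
  have ik : ∀ j, Integrable (k j) P := fun j => integrable_of_abs_le (hkm j) (hkabs j)
  have ig : Integrable g P := integrable_of_abs_le hgm hgC
  have ig2 : Integrable (fun x => g x ^ 2) P := integrable_of_abs_le (hgm.pow_const 2) hg2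
  have igk : ∀ j, Integrable (fun x => g x * k j x) P := fun j =>
    integrable_of_abs_le (hgm.mul (hkm j)) (C := C * 1) fun x => by
      rw [abs_mul]; exact mul_le_mul (hgC x) (hkabs j x) (abs_nonneg _) ((abs_nonneg _).trans (hgC x))
  have ig2k : ∀ j, Integrable (fun x => g x ^ 2 * k j x) P := fun j =>
    integrable_of_abs_le ((hgm.pow_const 2).mul (hkm j)) (C := C ^ 2 * 1) fun x => by
      rw [abs_mul]; exact mul_le_mul (hg2 x) (hkabs j x) (abs_nonneg _) (sq_nonneg _)
  have hq0 : ∀ j, 0 ≤ q j := fun j => integral_nonneg (hk0 j)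
  have hqk : ∀ j x, k j x ≤ Real.exp ε * q j := fun j x => by
    have : ∫ _, k j x ∂P ≤ ∫ y, Real.exp ε * k j y ∂P :=
      integral_mono (integrable_const _) ((ik j).const_mul _) (fun y => hL j x y)
    simpa [integral_const_mul] using this
  have hqz : ∀ j, q j = 0 → ∀ x, k j x = 0 := fun j hj x =>
    le_antisymm (by simpa [hj] using hqk j x) (hk0 j x)
  have hq1 : ∑ j ∈ s, q j = 1 := by
    rw [hq, ← integral_finsetSum s fun j _ => ik j]
    simp [hsum]
  -- When `q j = 0` the inverse is `0`, but then `k j` vanishes identically and so does `G j`.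
  have hwG : ∀ j, (q j)⁻¹ * (q j * G j) = G j := fun j => by
    by_cases h0 : q j = 0
    · simp [hG, hqz j h0]
    · field_simp
  -- The overlap bound times `(g x - g y)²`, expanded into products of a function of `x` and one of
  -- `y`. Integrating in `y` and then in `x` turns the left side into `(1 - Υ_ε) · 2V` and the right
  -- side into `2V - 2 ∑ tⱼ²/qⱼ`.
  have key : ∀ x y, (1 - Upsilon ε) * (g x - g y) ^ 2 ≤
      ∑ j ∈ s, (q j)⁻¹ * ((k j x * g x ^ 2) * k j y + (-2 * (k j x * g x)) * (g y * k j y)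
        + k j x * (g y ^ 2 * k j y)) := fun x y => by
    refine (mul_le_mul_of_nonneg_right (one_sub_Upsilon_le_overlap s (k := fun j => k j x)
      (k' := fun j => k j y) (q := q) (fun j _ => hq0 j)
      (fun j _ h0 => ⟨hqz j h0 x, hqz j h0 y⟩) (fun j _ => hL j x y) (fun j _ => hL j y x)
      (hsum x) (hsum y) hq1) (sq_nonneg _)).trans_eq ?_
    rw [Finset.sum_mul]
    exact Finset.sum_congr rfl fun j _ => by ring
  have hexp : ∀ x y, (g x - g y) ^ 2 = g x ^ 2 * 1 + (-2 * g x) * g y + 1 * g y ^ 2 :=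
    fun x y => by ring
  have inner : ∀ x, (1 - Upsilon ε) * (1 * g x ^ 2 + 0 * g x + V * 1) ≤
      ∑ j ∈ s, (q j)⁻¹ * (q j * (g x ^ 2 * k j x) + (-2 * t j) * (g x * k j x) + G j * k j x) :=
    fun x => by
    have e1 : ∫ y, (g x - g y) ^ 2 ∂P = 1 * g x ^ 2 + 0 * g x + V * 1 := by
      simp_rw [hexp]
      rw [integral_linear_comb (integrable_const 1) ig ig2, hg0]
      simp [hV]
    rw [← e1, ← integral_const_mul]
    have i1 : Integrable (fun y => (g x - g y) ^ 2) P := by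
      simp_rw [hexp]
      exact integrable_linear_comb (integrable_const 1) ig ig2 _ _ _
    refine (integral_mono (i1.const_mul _) (integrable_finsetSum _ fun j _ =>
      (integrable_linear_comb (ik j) (igk j) (ig2k j) _ _ _).const_mul _) (key x)).trans_eq ?_
    rw [integral_finsetSum _ fun j _ =>
      (integrable_linear_comb (ik j) (igk j) (ig2k j) _ _ _).const_mul _]
    refine Finset.sum_congr rfl fun j _ => ?_
    rw [integral_const_mul, integral_linear_comb (ik j) (igk j) (ig2k j)]
    change (q j)⁻¹ * (k j x * g x ^ 2 * q j + -2 * (k j x * g x) * t j + k j x * G j) = _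
    ring
  have outer : (1 - Upsilon ε) * (1 * V + 0 * ∫ x, g x ∂P + V * ∫ _, 1 ∂P) ≤
      ∑ j ∈ s, (q j)⁻¹ * (q j * G j + (-2 * t j) * t j + G j * q j) := by
    have := integral_mono (μ := P)
      ((integrable_linear_comb ig2 ig (integrable_const 1) 1 0 V).const_mul _)
      (integrable_finsetSum _ fun j _ =>
        (integrable_linear_comb (ig2k j) (igk j) (ik j) (q j) (-2 * t j) (G j)).const_mul _) inner
    rw [integral_const_mul, integral_linear_comb ig2 ig (integrable_const 1),
      integral_finsetSum _ fun j _ =>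
        (integrable_linear_comb (ig2k j) (igk j) (ik j) (q j) (-2 * t j) (G j)).const_mul _] at this
    refine this.trans_eq (Finset.sum_congr rfl fun j _ => ?_)
    rw [integral_const_mul, integral_linear_comb (ig2k j) (igk j) (ik j)]
  simp only [integral_const, probReal_univ, one_smul, mul_one, zero_mul, one_mul, add_zero]
    at outer
  have hGV : ∑ j ∈ s, G j = V := by
    rw [hG, ← integral_finsetSum s fun j _ => ig2k j]
    simp_rw [← Finset.mul_sum, hsum, mul_one]
    rfl
  have e2 : ∑ j ∈ s, (q j)⁻¹ * (q j * G j + (-2 * t j) * t j + G j * q j) =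
      2 * V - 2 * ∑ j ∈ s, (q j)⁻¹ * t j ^ 2 := by
    rw [← hGV, Finset.mul_sum, Finset.mul_sum, ← Finset.sum_sub_distrib]
    refine Finset.sum_congr rfl fun j _ => ?_
    linear_combination 2 * hwG j
  rw [e2] at outer
  linarith

/-- The variance of the mean response `∑ⱼ cⱼ kⱼ` of a locally private channel with finitely many
outputs. -/
lemma variance_sum_le {ι : Type*} (s : Finset ι) {ε : ℝ} {k : ι → X → ℝ} {c : ι → ℝ}
    (hkm : ∀ j, Measurable (k j)) (hk0 : ∀ j x, 0 ≤ k j x) (hk1 : ∀ j x, k j x ≤ 1)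
    (hsum : ∀ x, ∑ j ∈ s, k j x = 1) (hL : ∀ j x y, k j x ≤ Real.exp ε * k j y) :
    ∫ x, (∑ j ∈ s, c j * k j x - ∫ y, ∑ j ∈ s, c j * k j y ∂P) ^ 2 ∂P ≤
      Upsilon ε * ∑ j ∈ s, c j ^ 2 * ∫ x, k j x ∂P := by
  set a := ∫ y, ∑ j ∈ s, c j * k j y ∂P with ha
  set g : X → ℝ := fun x => ∑ j ∈ s, c j * k j x - a with hg
  set V := ∫ x, g x ^ 2 ∂P with hV
  have hfm : Measurable fun x => ∑ j ∈ s, c j * k j x :=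
    Finset.measurable_sum _ fun j _ => (hkm j).const_mul _
  have hkabs : ∀ j x, |k j x| ≤ 1 := fun j x => by rw [abs_of_nonneg (hk0 j x)]; exact hk1 j x
  have hfC : ∀ x, |∑ j ∈ s, c j * k j x| ≤ ∑ j ∈ s, |c j| := fun x =>
    (Finset.abs_sum_le_sum_abs _ _).trans <| Finset.sum_le_sum fun j _ => by
      rw [abs_mul]; exact mul_le_of_le_one_right (abs_nonneg _) (hkabs j x)
  have hgm : Measurable g := hfm.sub_const _
  have hgC : ∀ x, |g x| ≤ ∑ j ∈ s, |c j| + |a| := fun x =>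
    (abs_sub _ _).trans (add_le_add_left (hfC x) _)
  have hg0 : ∫ x, g x ∂P = 0 := by
    rw [hg, integral_sub (integrable_of_abs_le hfm hfC) (integrable_const _)]
    simp [ha]
  have ik : ∀ j, Integrable (k j) P := fun j => integrable_of_abs_le (hkm j) (hkabs j)
  have igk : ∀ j, Integrable (fun x => g x * k j x) P := fun j =>
    (ik j).bdd_mul hgm.aestronglyMeasurable (ae_of_all _ hgC)
  have ig : Integrable g P := integrable_of_abs_le hgm hgC
  have hq0 : ∀ j, 0 ≤ ∫ x, k j x ∂P := fun j => integral_nonneg (hk0 j)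
  -- As `g` is centred, its second moment is its pairing with the uncentred response. Cauchy–Schwarz
  -- over the outputs and the contraction for `g` then give `V² ≤ S · Υ_ε V` with `S = ∑ cⱼ² qⱼ`,
  -- and one factor `V` cancels.
  have hV' : V = ∑ j ∈ s, c j * ∫ x, g x * k j x ∂P := by
    have : ∀ x, g x ^ 2 = ∑ j ∈ s, c j * (g x * k j x) - a * g x := fun x => by
      have : ∑ j ∈ s, c j * (g x * k j x) = g x * ∑ j ∈ s, c j * k j x := by
        rw [Finset.mul_sum]; exact Finset.sum_congr rfl fun j _ => by ring
      rw [this]; simp only [hg]; ring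
    rw [hV]
    simp_rw [this]
    rw [integral_sub (integrable_finsetSum _ fun j _ => (igk j).const_mul _) (ig.const_mul _),
      integral_const_mul, hg0, integral_finsetSum _ fun j _ => (igk j).const_mul _]
    simp_rw [integral_const_mul]
    simp
  have hS := sum_sq_condMean_le (P := P) s hkm hk0 hk1 hsum hL hgm hgC hg0
  have hCS : V ^ 2 ≤ (∑ j ∈ s, c j ^ 2 * ∫ x, k j x ∂P) *
      ∑ j ∈ s, (∫ x, k j x ∂P)⁻¹ * (∫ x, g x * k j x ∂P) ^ 2 := by
    rw [hV']
    refine Finset.sum_sq_le_sum_mul_sum_of_sq_le_mul s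
      (fun j _ => mul_nonneg (sq_nonneg _) (hq0 j))
      (fun j _ => mul_nonneg (inv_nonneg.2 (hq0 j)) (sq_nonneg _)) fun j _ => ?_
    by_cases h0 : ∫ x, k j x ∂P = 0
    · have hz : k j =ᵐ[P] 0 := (integral_eq_zero_iff_of_nonneg (hk0 j) (ik j)).1 h0
      have : ∫ x, g x * k j x ∂P = 0 := by
        rw [integral_eq_zero_of_ae]
        filter_upwards [hz] with x hx
        simp [hx]
      simp [this]
    · apply le_of_eq; field_simp
  have hV0 : 0 ≤ V := integral_nonneg fun x => sq_nonneg _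
  have hS0 : 0 ≤ ∑ j ∈ s, c j ^ 2 * ∫ x, k j x ∂P :=
    Finset.sum_nonneg fun j _ => mul_nonneg (sq_nonneg _) (hq0 j)
  rcases hV0.eq_or_lt with h | h
  · rw [← h]; exact mul_nonneg (Upsilon_nonneg ε) hS0
  · have := hCS.trans (mul_le_mul_of_nonneg_left hS hS0)
    refine le_of_mul_le_mul_right ?_ h
    linarith [sq V]

end Contraction

/-! ### Contraction and bounded conditional means for general locally private mechanisms. -/

section Mechanism

variable {X V : Type*} [MeasurableSpace X] [MeasurableSpace V]

lemma integral_bind_kernel {P : Measure X} (κ : Kernel X V) {φ : V → ℝ}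
    (hφ : Integrable φ (κ ∘ₘ P)) : ∫ v, φ v ∂(κ ∘ₘ P) = ∫ x, ∫ v, φ v ∂(κ x) ∂P := by
  have e : (κ ∘ₖ Kernel.const Unit P) () = κ ∘ₘ P := by
    rw [Kernel.comp_const, Kernel.const_apply]
  have := Kernel.integral_comp (η := κ) (κ := Kernel.const Unit P) (a := ()) (f := φ) (e ▸ hφ)
  rwa [e, Kernel.const_apply] at this

lemma abs_integral_le_of_abs_le {P : Measure X} [IsProbabilityMeasure P] {f : X → ℝ}
    {C : ℝ} (hC : ∀ x, |f x| ≤ C) : |∫ x, f x ∂P| ≤ C := by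
  have : ∀ x, ‖f x‖ ≤ C := hC
  simpa using norm_integral_le_of_norm_le_const (μ := P) (ae_of_all _ this)

lemma abs_integral_kernel_le (κ : Kernel X V) [IsMarkovKernel κ] {φ : V → ℝ}
    {C : ℝ} (hC : ∀ v, |φ v| ≤ C) (x : X) : |∫ v, φ v ∂(κ x)| ≤ C :=
  abs_integral_le_of_abs_le hC

lemma measurable_integral_kernel (κ : Kernel X V) {φ : V → ℝ} (hφ : Measurable φ) :
    Measurable fun x => ∫ v, φ v ∂(κ x) :=
  (hφ.stronglyMeasurable.integral_kernel (κ := κ)).measurable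

lemma IsLDP.real_le {ε : ℝ} {κ : Kernel X V} [IsMarkovKernel κ] (h : IsLDP ε κ) (x x' : X)
    {A : Set V} (hA : MeasurableSet A) : (κ x).real A ≤ Real.exp ε * (κ x').real A := by
  have := ENNReal.toReal_mono (ENNReal.mul_ne_top ENNReal.ofReal_ne_top (measure_ne_top _ _))
    (h x x' A hA)
  rwa [ENNReal.toReal_mul, ENNReal.toReal_ofReal (Real.exp_pos ε).le] at this

/-- Only the level sets of `φ` matter, so the mechanism reduces to a channel whose finitely many
outputs are the values of `φ`. -/
lemma variance_simpleFunc_le {P : Measure X} [IsProbabilityMeasure P] {ε : ℝ} {κ : Kernel X V}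
    [IsMarkovKernel κ] (h : IsLDP ε κ) (φ : SimpleFunc V ℝ) :
    ∫ x, (∫ v, φ v ∂(κ x) - ∫ y, ∫ v, φ v ∂(κ y) ∂P) ^ 2 ∂P ≤
      Upsilon ε * ∫ x, ∫ v, φ v ^ 2 ∂(κ x) ∂P := by
  have hA : ∀ c, MeasurableSet (φ ⁻¹' {c}) := fun c => φ.measurableSet_fiber c
  have hint : ∀ x (ψ : SimpleFunc V ℝ), Integrable ψ (κ x) := fun x ψ =>
    SimpleFunc.integrable_of_isFiniteMeasure ψ
  have e1 : ∀ x, ∫ v, φ v ∂(κ x) = ∑ c ∈ φ.range, c * (κ x).real (φ ⁻¹' {c}) := fun x => by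
    rw [SimpleFunc.integral_eq_sum φ (hint x φ)]
    exact Finset.sum_congr rfl fun c _ => by rw [smul_eq_mul, mul_comm]
  have e2 : ∀ x, ∫ v, φ v ^ 2 ∂(κ x) = ∑ c ∈ φ.range, c ^ 2 * (κ x).real (φ ⁻¹' {c}) := fun x => by
    have := SimpleFunc.map_integral φ (fun c : ℝ => c ^ 2) (hint x φ) (by simp)
    rw [SimpleFunc.integral_eq_integral _ (hint x _)] at this
    refine this.trans (Finset.sum_congr rfl fun c _ => by rw [smul_eq_mul, mul_comm])
  have hkm : ∀ c, Measurable fun x => (κ x).real (φ ⁻¹' {c}) := fun c =>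
    (κ.measurable_coe (hA c)).ennreal_toReal
  have ik : ∀ c, Integrable (fun x => (κ x).real (φ ⁻¹' {c})) P := fun c =>
    integrable_of_abs_le (hkm c) (C := 1) fun x => by
      rw [abs_of_nonneg measureReal_nonneg]; exact measureReal_le_one
  have hsum : ∀ x, ∑ c ∈ φ.range, (κ x).real (φ ⁻¹' {c}) = 1 := fun x => by
    rw [← measureReal_biUnion_finset (fun a _ b _ hab =>
      Disjoint.preimage _ (Set.disjoint_singleton.2 hab)) fun c _ => hA c]
    have : ⋃ c ∈ φ.range, φ ⁻¹' {c} = Set.univ := by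
      ext v; simp
    rw [this, probReal_univ]
  have := variance_sum_le (P := P) φ.range (ε := ε) (c := id)
    (k := fun c x => (κ x).real (φ ⁻¹' {c})) hkm (fun _ _ => measureReal_nonneg)
    (fun _ _ => measureReal_le_one) hsum fun c x y => h.real_le x y (hA c)
  simp_rw [e1, e2]
  refine this.trans_eq ?_
  rw [integral_finsetSum _ fun c _ => (ik c).const_mul _]
  simp_rw [integral_const_mul]
  rfl

/-- The variance of the mean response of a locally private mechanism contracts by `Υ_ε`. -/
lemma IsLDP.variance_le {P : Measure X} [IsProbabilityMeasure P] {ε : ℝ} {κ : Kernel X V}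
    [IsMarkovKernel κ] (h : IsLDP ε κ) {φ : V → ℝ} (hφ : Measurable φ) {C : ℝ}
    (hC : ∀ v, |φ v| ≤ C) :
    ∫ x, (∫ v, φ v ∂(κ x) - ∫ y, ∫ v, φ v ∂(κ y) ∂P) ^ 2 ∂P ≤
      Upsilon ε * ∫ x, ∫ v, φ v ^ 2 ∂(κ x) ∂P := by
  obtain ⟨x0⟩ : Nonempty X := P.nonempty_of_neZero
  have hV : Nonempty V := (κ x0).nonempty_of_neZero
  have hC0 : 0 ≤ C := (abs_nonneg _).trans (hC hV.some)
  have hs := hφ.stronglyMeasurable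
  -- These simple functions keep the bound `C`, so constants dominate every limit below.
  set ψ := hs.approxBounded C with hψ
  have hψC : ∀ n v, |ψ n v| ≤ C := fun n v => hs.norm_approxBounded_le hC0 n v
  have hψm : ∀ n, Measurable (ψ n) := fun n => (ψ n).measurable
  have hlim : ∀ v, Tendsto (fun n => ψ n v) atTop (𝓝 (φ v)) := fun v =>
    hs.tendsto_approxBounded_of_norm_le (hC v)
  have hsqC : ∀ n v, |ψ n v ^ 2| ≤ C ^ 2 := fun n v => by
    rw [abs_pow]; exact pow_le_pow_left₀ (abs_nonneg _) (hψC n v) 2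
  have l1 : ∀ x, Tendsto (fun n => ∫ v, ψ n v ∂(κ x)) atTop (𝓝 (∫ v, φ v ∂(κ x))) := fun x =>
    tendsto_integral_of_dominated_convergence (fun _ => C) (fun n => (hψm n).aestronglyMeasurable)
      (integrable_const _) (fun n => ae_of_all _ (hψC n)) (ae_of_all _ hlim)
  have l2 : ∀ x, Tendsto (fun n => ∫ v, ψ n v ^ 2 ∂(κ x)) atTop (𝓝 (∫ v, φ v ^ 2 ∂(κ x))) :=
    fun x => tendsto_integral_of_dominated_convergence (fun _ => C ^ 2)
      (fun n => ((hψm n).pow_const 2).aestronglyMeasurable)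
      (integrable_const _) (fun n => ae_of_all _ (hsqC n)) (ae_of_all _ fun v => (hlim v).pow 2)
  have l3 : Tendsto (fun n => ∫ x, ∫ v, ψ n v ^ 2 ∂(κ x) ∂P) atTop
      (𝓝 (∫ x, ∫ v, φ v ^ 2 ∂(κ x) ∂P)) :=
    tendsto_integral_of_dominated_convergence (fun _ => C ^ 2)
      (fun n => (measurable_integral_kernel κ ((hψm n).pow_const 2)).aestronglyMeasurable)
      (integrable_const _) (fun n => ae_of_all _ fun x => abs_integral_kernel_le κ (hsqC n) x)
      (ae_of_all _ l2)
  have l4 : Tendsto (fun n => ∫ x, ∫ v, ψ n v ∂(κ x) ∂P) atTop (𝓝 (∫ x, ∫ v, φ v ∂(κ x) ∂P)) :=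
    tendsto_integral_of_dominated_convergence (fun _ => C)
      (fun n => (measurable_integral_kernel κ (hψm n)).aestronglyMeasurable)
      (integrable_const _) (fun n => ae_of_all _ fun x => abs_integral_kernel_le κ (hψC n) x)
      (ae_of_all _ l1)
  have l5 : Tendsto (fun n => ∫ x, (∫ v, ψ n v ∂(κ x) - ∫ y, ∫ v, ψ n v ∂(κ y) ∂P) ^ 2 ∂P) atTop
      (𝓝 (∫ x, (∫ v, φ v ∂(κ x) - ∫ y, ∫ v, φ v ∂(κ y) ∂P) ^ 2 ∂P)) := by
    refine tendsto_integral_of_dominated_convergence (fun _ => (C + C) ^ 2)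
      (fun n => (((measurable_integral_kernel κ (hψm n)).sub_const _).pow_const
        2).aestronglyMeasurable)
      (integrable_const _) (fun n => ae_of_all _ fun x => ?_)
      (ae_of_all _ fun x => ((l1 x).sub l4).pow 2)
    rw [Real.norm_eq_abs, abs_pow]
    refine pow_le_pow_left₀ (abs_nonneg _) ((abs_sub _ _).trans
      (add_le_add (abs_integral_kernel_le κ (hψC n) x) ?_)) 2
    exact abs_integral_le_of_abs_le (abs_integral_kernel_le κ (hψC n))
  exact le_of_tendsto_of_tendsto' l5 (l3.const_mul _) fun n => variance_simpleFunc_le h (ψ n)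

/-- The quadratic `a ↦ ∫ (a g + f)²` is nonnegative, so its discriminant is not positive. -/
lemma sq_integral_mul_le {P : Measure X} {f g : X → ℝ} (hf : Integrable (fun x => f x ^ 2) P)
    (hg : Integrable (fun x => g x ^ 2) P) (hfg : Integrable (fun x => f x * g x) P) :
    (∫ x, f x * g x ∂P) ^ 2 ≤ (∫ x, f x ^ 2 ∂P) * ∫ x, g x ^ 2 ∂P := by
  have : discrim (∫ x, g x ^ 2 ∂P) (2 * ∫ x, f x * g x ∂P) (∫ x, f x ^ 2 ∂P) ≤ 0 := by
    refine discrim_le_zero fun a => ?_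
    have e : ∫ x, (a * g x + f x) ^ 2 ∂P = (a * a) * ∫ x, g x ^ 2 ∂P +
        (2 * a) * ∫ x, f x * g x ∂P + 1 * ∫ x, f x ^ 2 ∂P := by
      rw [← integral_linear_comb hg hfg hf]
      exact integral_congr_ae (ae_of_all _ fun x => by ring)
    have h0 : 0 ≤ ∫ x, (a * g x + f x) ^ 2 ∂P := integral_nonneg fun x => sq_nonneg _
    rw [e] at h0
    linarith
  rw [discrim] at this
  linarith

/-- Average the privacy inequality over the second input. The resulting domination by the output law
is the source of every uniform bound below. -/
lemma IsLDP.le_comp {P : Measure X} [IsProbabilityMeasure P] {ε : ℝ} {κ : Kernel X V}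
    (h : IsLDP ε κ) (x : X) {A : Set V} (hA : MeasurableSet A) :
    κ x A ≤ ENNReal.ofReal (Real.exp ε) * (κ ∘ₘ P) A := by
  rw [Measure.bind_apply hA κ.aemeasurable, ← lintegral_const_mul _ (κ.measurable_coe hA)]
  calc κ x A = ∫⁻ _, κ x A ∂P := by simp
    _ ≤ _ := lintegral_mono fun y => h x y A hA

/-- Integrating `h` against a locally private mechanism gives a measure with bounded density. -/
lemma IsLDP.abs_integral_mul_le {μ P : Measure X} [IsProbabilityMeasure P] {ε : ℝ}
    {κ : Kernel X V} [IsMarkovKernel κ] (hκ : IsLDP ε κ) {h : X → ℝ} (hh : Integrable h μ)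
    {A : Set V} (hA : MeasurableSet A) :
    |∫ x, h x * (κ x).real A ∂μ| ≤ (Real.exp ε * ∫ x, |h x| ∂μ) * (κ ∘ₘ P).real A := by
  have hb : ∀ x, (κ x).real A ≤ Real.exp ε * (κ ∘ₘ P).real A := fun x => by
    have := ENNReal.toReal_mono (ENNReal.mul_ne_top ENNReal.ofReal_ne_top (measure_ne_top _ _))
      (hκ.le_comp (P := P) x hA)
    rwa [ENNReal.toReal_mul, ENNReal.toReal_ofReal (Real.exp_pos ε).le] at this
  refine (norm_integral_le_of_norm_le (f := fun x => h x * (κ x).real A) (hh.abs.mul_const (Real.exp ε * (κ ∘ₘ P).real A))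
    (ae_of_all _ fun x => ?_)).trans_eq ?_
  · rw [Real.norm_eq_abs, abs_mul, abs_of_nonneg (measureReal_nonneg (s := A))]
    exact mul_le_mul_of_nonneg_left (hb x) (abs_nonneg _)
  · rw [integral_mul_const]; ring

/-- The conditional mean of a nonnegative `h`, without its bound. -/
lemma exists_integrable_posterior_mean {P : Measure X} [IsProbabilityMeasure P]
    (κ : Kernel X V) [IsMarkovKernel κ] {h : X → ℝ} (hh : Integrable h P) :
    ∃ t : V → ℝ, Measurable t ∧ Integrable t (κ ∘ₘ P) ∧
      ∀ φ : V → ℝ, Measurable φ → ∀ C, (∀ v, |φ v| ≤ C) →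
        ∫ v, t v * φ v ∂(κ ∘ₘ P) = ∫ x, max (h x) 0 * ∫ v, φ v ∂(κ x) ∂P := by
  -- `ENNReal.ofReal` keeps only the positive part of `h`, whence the `max` in the conclusion. The
  -- conditional mean is the density of the output of `N`.
  set N := P.withDensity fun x => ENNReal.ofReal (h x) with hN
  have hfin : IsFiniteMeasure N := isFiniteMeasure_withDensity_ofReal hh.2
  have hac : κ ∘ₘ N ≪ κ ∘ₘ P := (withDensity_absolutelyContinuous _ _).comp_right κ
  refine ⟨fun v => ((κ ∘ₘ N).rnDeriv (κ ∘ₘ P) v).toReal,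
    (Measure.measurable_rnDeriv _ _).ennreal_toReal, Measure.integrable_toReal_rnDeriv,
    fun φ hφ C hC => ?_⟩
  have := integral_rnDeriv_smul hac (f := φ)
  simp only [smul_eq_mul] at this
  rw [this, integral_bind_kernel κ (integrable_of_abs_le hφ hC), hN,
    integral_withDensity_eq_integral_toReal_smul₀ hh.aestronglyMeasurable.aemeasurable.ennreal_ofReal
      (ae_of_all _ fun _ => ENNReal.ofReal_lt_top)]
  refine integral_congr_ae (ae_of_all _ fun x => ?_)
  simp only [smul_eq_mul]
  rfl

lemma ae_abs_le_of_setIntegral {J : Measure V} [IsFiniteMeasure J] {f : V → ℝ}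
    (hf : Integrable f J) {c : ℝ}
    (h : ∀ A, MeasurableSet A → |∫ v in A, f v ∂J| ≤ c * J.real A) : ∀ᵐ v ∂J, |f v| ≤ c := by
  have h1 : f ≤ᵐ[J] fun _ => c := ae_le_of_forall_setIntegral_le hf (integrable_const _)
    fun A hA _ => by
      simp only [setIntegral_const, smul_eq_mul]
      linarith [(abs_le.1 (h A hA)).2]
  have h2 : (fun _ => -c) ≤ᵐ[J] f := ae_le_of_forall_setIntegral_le (integrable_const _) hf
    fun A hA _ => by
      simp only [setIntegral_const, smul_eq_mul]
      linarith [(abs_le.1 (h A hA)).1]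
  filter_upwards [h1, h2] with v a b using abs_le.2 ⟨b, a⟩

/-- The conditional mean `t(v) = 𝔼[h(X) | V = v]` under a locally private mechanism is bounded. -/
lemma IsLDP.exists_posterior_mean {P : Measure X} [IsProbabilityMeasure P] {ε : ℝ}
    {κ : Kernel X V} [IsMarkovKernel κ] (hκ : IsLDP ε κ) {h : X → ℝ} (hh : Integrable h P) :
    ∃ t : V → ℝ, Measurable t ∧ (∃ B, ∀ v, |t v| ≤ B) ∧
      ∀ φ : V → ℝ, Measurable φ → ∀ C, (∀ v, |φ v| ≤ C) →
        ∫ v, t v * φ v ∂(κ ∘ₘ P) = ∫ x, h x * ∫ v, φ v ∂(κ x) ∂P := by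
  obtain ⟨t1, m1, i1, e1⟩ := exists_integrable_posterior_mean κ hh
  obtain ⟨t2, m2, i2, e2⟩ := exists_integrable_posterior_mean κ hh.neg
  have hK : ∀ φ : V → ℝ, Measurable φ → ∀ C, (∀ v, |φ v| ≤ C) →
      ∫ v, (t1 v - t2 v) * φ v ∂(κ ∘ₘ P) = ∫ x, h x * ∫ v, φ v ∂(κ x) ∂P := fun φ hφ C hC => by
    have hb1 : ∀ {t : V → ℝ}, Integrable t (κ ∘ₘ P) → Integrable (fun v => t v * φ v) (κ ∘ₘ P) :=
      fun ht => ht.mul_bdd hφ.aestronglyMeasurable (ae_of_all _ hC)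
    have hb2 : ∀ {t : X → ℝ}, Integrable t P → Integrable (fun x => t x * ∫ v, φ v ∂(κ x)) P :=
      fun ht => ht.mul_bdd (measurable_integral_kernel κ hφ).aestronglyMeasurable
        (ae_of_all _ (abs_integral_kernel_le κ hC))
    simp_rw [sub_mul]
    rw [integral_sub (hb1 i1) (hb1 i2), e1 φ hφ C hC, e2 φ hφ C hC,
      ← integral_sub (hb2 hh.pos_part) (hb2 hh.neg.pos_part)]
    refine integral_congr_ae (ae_of_all _ fun x => ?_)
    simp only [Pi.neg_apply, ← sub_mul]
    congr 1
    rcases le_total 0 (h x) with h0 | h0 <;> simp [h0]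
  set c := Real.exp ε * ∫ x, |h x| ∂P with hc
  have hc0 : 0 ≤ c := mul_nonneg (Real.exp_pos ε).le (integral_nonneg fun _ => abs_nonneg _)
  have hae : ∀ᵐ v ∂(κ ∘ₘ P), |t1 v - t2 v| ≤ c := by
    refine ae_abs_le_of_setIntegral (i1.sub i2) fun A hA => ?_
    have := hK (A.indicator 1) (measurable_one.indicator hA) 1 fun v => by
      by_cases hv : v ∈ A <;> simp [hv]
    simp_rw [integral_indicator_one hA] at this
    have e : ∫ v in A, (t1 - t2) v ∂(κ ∘ₘ P) = ∫ x, h x * (κ x).real A ∂P := by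
      rw [← this, ← integral_indicator hA]
      refine integral_congr_ae (ae_of_all _ fun v => ?_)
      by_cases hv : v ∈ A <;> simp [hv]
    rw [e]
    exact hκ.abs_integral_mul_le hh hA
  -- Clipping at `±c` changes nothing almost everywhere and makes the bound hold at every point.
  refine ⟨fun v => max (-c) (min c (t1 v - t2 v)),
    measurable_const.max (measurable_const.min (m1.sub m2)),
    ⟨c, fun v => abs_le.2 ⟨le_max_left _ _, max_le (by linarith) (min_le_left _ _)⟩⟩,
    fun φ hφ C hC => ?_⟩
  rw [← hK φ hφ C hC]
  refine integral_congr_ae ?_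
  filter_upwards [hae] with v hv
  rw [min_eq_right (abs_le.1 hv).2, max_eq_right (abs_le.1 hv).1]

/-- Contraction of the second moment of a centred `h` under a locally private mechanism. -/
lemma IsLDP.lintegral_sq_posterior_mean_le {P : Measure X} [IsProbabilityMeasure P] {ε : ℝ}
    {κ : Kernel X V} [IsMarkovKernel κ] (hκ : IsLDP ε κ) {h : X → ℝ} (hh : Integrable h P)
    (h0 : ∫ x, h x ∂P = 0) {t : V → ℝ} (ht : Measurable t) {B : ℝ} (hB : ∀ v, |t v| ≤ B)
    (hth : ∫ v, t v * t v ∂(κ ∘ₘ P) = ∫ x, h x * ∫ v, t v ∂(κ x) ∂P) :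
    ∫⁻ v, ENNReal.ofReal (t v ^ 2) ∂(κ ∘ₘ P) ≤
      ENNReal.ofReal (Upsilon ε) * ∫⁻ x, ENNReal.ofReal (h x ^ 2) ∂P := by
  set f : X → ℝ := fun x => ∫ v, t v ∂(κ x) with hf
  set c := ∫ x, f x ∂P with hc
  set T := ∫ v, t v ^ 2 ∂(κ ∘ₘ P) with hT
  have hfm : Measurable f := measurable_integral_kernel κ ht
  have hfB : ∀ x, |f x| ≤ B := abs_integral_kernel_le κ hB
  have hgm : Measurable fun x => f x - c := hfm.sub_const _
  have hgB : ∀ x, |f x - c| ≤ B + |c| := fun x => (abs_sub _ _).trans (add_le_add_left (hfB x) _)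
  have ig : Integrable (fun x => f x - c) P := integrable_of_abs_le hgm hgB
  have ig2 : Integrable (fun x => (f x - c) ^ 2) P :=
    integrable_of_abs_le (hgm.pow_const 2) (C := (B + |c|) ^ 2) fun x => by
      rw [abs_pow]; exact pow_le_pow_left₀ (abs_nonneg _) (hgB x) 2
  have ihg : Integrable (fun x => h x * (f x - c)) P :=
    hh.mul_bdd hgm.aestronglyMeasurable (ae_of_all _ hgB)
  have ihf : Integrable (fun x => h x * f x) P :=
    hh.mul_bdd hfm.aestronglyMeasurable (ae_of_all _ hfB)
  have it2 : Integrable (fun v => t v ^ 2) (κ ∘ₘ P) :=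
    integrable_of_abs_le (ht.pow_const 2) (C := B ^ 2) fun x => by
      rw [abs_pow]; exact pow_le_pow_left₀ (abs_nonneg _) (hB x) 2
  -- Since `h` is centred, the constant `c` may be subtracted freely. This leaves `T` as a pairing
  -- of `h` with a function of variance at most `Υ_ε T`, so `T² ≤ ∫ h² · Υ_ε T`.
  have hT' : T = ∫ x, h x * (f x - c) ∂P := by
    simp_rw [mul_sub]
    rw [integral_sub ihf (hh.mul_const c), integral_mul_const, h0, zero_mul, sub_zero, ← hth, hT]
    simp_rw [sq]
  have hT0 : 0 ≤ T := integral_nonneg fun _ => sq_nonneg _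
  have hvar : ∫ x, (f x - c) ^ 2 ∂P ≤ Upsilon ε * T := by
    rw [hT, integral_bind_kernel κ it2]
    exact hκ.variance_le ht hB
  rw [← ofReal_integral_eq_lintegral_ofReal it2 (ae_of_all _ fun _ => sq_nonneg _)]
  by_cases hfin : Integrable (fun x => h x ^ 2) P
  · rw [← ofReal_integral_eq_lintegral_ofReal hfin (ae_of_all _ fun _ => sq_nonneg _),
      ← ENNReal.ofReal_mul (Upsilon_nonneg ε)]
    refine ENNReal.ofReal_le_ofReal ?_
    have hH0 : 0 ≤ ∫ x, h x ^ 2 ∂P := integral_nonneg fun _ => sq_nonneg _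
    have hCS := sq_integral_mul_le hfin ig2 ihg
    rw [← hT'] at hCS
    rcases hT0.eq_or_lt with h | h
    · rw [← hT, ← h]; exact mul_nonneg (Upsilon_nonneg ε) hH0
    · refine le_of_mul_le_mul_right ?_ h
      rw [← hT]
      linarith [sq T, mul_le_mul_of_nonneg_left hvar hH0]
  -- With infinite second moment only `Υ_ε = 0` needs an argument, because `0 * ∞ = 0`: the mean
  -- response is then almost surely constant and `T = 0`.
  · have htop : ∫⁻ x, ENNReal.ofReal (h x ^ 2) ∂P = ∞ := by
      by_contra hne
      refine hfin ⟨hh.aestronglyMeasurable.pow 2, ?_⟩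
      rw [hasFiniteIntegral_iff_ofReal (ae_of_all _ fun _ => sq_nonneg _)]
      exact lt_top_iff_ne_top.2 hne
    rw [htop]
    rcases (Upsilon_nonneg ε).eq_or_lt with hU | hU
    · rw [← hU, zero_mul] at hvar
      have hz : (fun x => (f x - c) ^ 2) =ᵐ[P] 0 :=
        (integral_eq_zero_iff_of_nonneg (fun _ => sq_nonneg _) ig2).1
          (le_antisymm hvar (integral_nonneg fun _ => sq_nonneg _))
      have : T = 0 := by
        rw [hT', integral_eq_zero_of_ae]
        filter_upwards [hz] with x hx
        simp [pow_eq_zero_iff (two_ne_zero) |>.1 hx]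
      rw [← hT, this]; simp
    · rw [ENNReal.mul_top (by simpa using hU)]; exact le_top

end Mechanism

/-! ### First-order expansion of the input densities. -/

section Regularity

variable {X : Type*} [MeasurableSpace X] {d : ℕ} {Θ : Set (EuclideanSpace ℝ (Fin d))}
  {P : EuclideanSpace ℝ (Fin d) → Measure X} {μ : Measure X}
  {p : EuclideanSpace ℝ (Fin d) → X → ℝ} {θ : EuclideanSpace ℝ (Fin d)}

lemma IsDensityFamily.integral_eq (hp : IsDensityFamily Θ P μ p) (hθ : θ ∈ Θ) (f : X → ℝ) :
    ∫ x, f x ∂(P θ) = ∫ x, p θ x * f x ∂μ := by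
  rw [hp.withDensity_eq θ hθ, integral_withDensity_eq_integral_toReal_smul₀
    (hp.measurable θ hθ).ennreal_ofReal.aemeasurable (ae_of_all _ fun _ => ENNReal.ofReal_lt_top)]
  simp_rw [ENNReal.toReal_ofReal (hp.nonneg θ hθ _), smul_eq_mul]

lemma IsDensityFamily.integrable_iff (hp : IsDensityFamily Θ P μ p) (hθ : θ ∈ Θ) {f : X → ℝ} :
    Integrable f (P θ) ↔ Integrable (fun x => p θ x * f x) μ := by
  rw [hp.withDensity_eq θ hθ, integrable_withDensity_iff_integrable_smul'
    (hp.measurable θ hθ).ennreal_ofReal (ae_of_all _ fun _ => ENNReal.ofReal_lt_top)]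
  simp_rw [ENNReal.toReal_ofReal (hp.nonneg θ hθ _), smul_eq_mul]

lemma IsDensityFamily.integrable (hp : IsDensityFamily Θ P μ p) (hθ : θ ∈ Θ)
    [IsFiniteMeasure (P θ)] : Integrable (p θ) μ := by
  simpa using (hp.integrable_iff hθ).1 (integrable_const (1 : ℝ))

/-- The remainder of the first-order expansion of the density. -/
noncomputable def remainder (Θ : Set (EuclideanSpace ℝ (Fin d))) (p : EuclideanSpace ℝ (Fin d) → X → ℝ)
    (θ θ' : EuclideanSpace ℝ (Fin d)) (x : X) : ℝ :=
  p θ' x - p θ x - p θ x * ⟪score Θ p θ x, θ' - θ⟫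

variable (hP : ∀ θ' ∈ Θ, IsProbabilityMeasure (P θ')) (hp : IsDensityFamily Θ P μ p) (hθ : θ ∈ Θ)
  (hreg : IsRegularAt Θ P μ p θ)

include hP hp hθ hreg

lemma IsRegularAt.integrable_remainder {θ' : EuclideanSpace ℝ (Fin d)} (hθ' : θ' ∈ Θ) :
    Integrable (remainder Θ p θ θ') μ := by
  have := hP θ hθ
  have := hP θ' hθ'
  exact ((hp.integrable hθ').sub (hp.integrable hθ)).sub
    ((hp.integrable_iff hθ).1 (hreg.integrable_score.inner_const _))

lemma IsRegularAt.integral_remainder_mul {θ' : EuclideanSpace ℝ (Fin d)} (hθ' : θ' ∈ Θ)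
    {f : X → ℝ} (hf : Measurable f) {C : ℝ} (hC : ∀ x, |f x| ≤ C) :
    ∫ x, remainder Θ p θ θ' x * f x ∂μ = ∫ x, f x ∂(P θ') - ∫ x, f x ∂(P θ) -
      ∫ x, ⟪score Θ p θ x, θ' - θ⟫ * f x ∂(P θ) := by
  have := hP θ hθ
  have := hP θ' hθ'
  have i1 := (hp.integrable_iff hθ').1 (integrable_of_abs_le (P := P θ') hf hC)
  have i2 := (hp.integrable_iff hθ).1 (integrable_of_abs_le (P := P θ) hf hC)
  have i3 := (hp.integrable_iff hθ).1 ((hreg.integrable_score.inner_const (θ' - θ)).mul_bdd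
    hf.aestronglyMeasurable (ae_of_all _ hC))
  have i12 : Integrable (fun x => p θ' x * f x - p θ x * f x) μ := i1.sub i2
  rw [hp.integral_eq hθ, hp.integral_eq hθ, hp.integral_eq hθ', ← integral_sub i1 i2,
    ← integral_sub i12 i3]
  refine integral_congr_ae (ae_of_all _ fun x => ?_)
  simp only [remainder]
  ring

/-- The score is centred. -/
lemma IsRegularAt.integral_inner_score (hΘ : UniqueDiffWithinAt ℝ Θ θ)
    (u : EuclideanSpace ℝ (Fin d)) : ∫ x, ⟪u, score Θ p θ x⟫ ∂(P θ) = 0 := by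
  set G := ∫ x, score Θ p θ x ∂(P θ) with hG
  have hGu : ∀ u, ⟪G, u⟫ = ∫ x, ⟪score Θ p θ x, u⟫ ∂(P θ) := fun u => by
    rw [real_inner_comm, hG, ← integral_inner hreg.integrable_score]
    simp_rw [real_inner_comm]
  have hbound : ∀ θ' ∈ Θ, |⟪G, θ' - θ⟫| ≤ ∫ x, |remainder Θ p θ θ' x| ∂μ := fun θ' hθ' => by
    have := hP θ hθ
    have := hP θ' hθ'
    have e := hreg.integral_remainder_mul hP hp hθ hθ' (f := fun _ => 1) measurable_const
      (C := 1) (fun _ => by simp)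
    simp only [mul_one, integral_const, probReal_univ, smul_eq_mul, sub_self, zero_sub, ← hGu] at e
    rw [← abs_neg, ← e]
    exact abs_integral_le_integral_abs
  -- Total mass is constant in the parameter, so testing the expansion with `1` shows that the
  -- linear form of `G` is also a derivative of the zero function along `Θ`. Uniqueness of
  -- derivatives forces it to vanish.
  have hd : HasFDerivWithinAt (fun _ : EuclideanSpace ℝ (Fin d) => (0 : ℝ)) (innerSL ℝ G) Θ θ := by
    rw [hasFDerivWithinAt_iff_isLittleO]
    refine IsBigO.trans_isLittleO ?_ hreg.isLittleO
    refine IsBigO.of_bound 1 ?_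
    filter_upwards [self_mem_nhdsWithin] with θ' hθ'
    simp only [sub_self, zero_sub, norm_neg, innerSL_apply_apply, one_mul]
    rw [Real.norm_eq_abs, Real.norm_eq_abs]
    exact (hbound θ' hθ').trans (le_abs_self _)
  have h0 := hΘ.eq hd (hasFDerivWithinAt_const (0 : ℝ) θ Θ)
  have : ⟪G, u⟫ = 0 := by
    rw [← innerSL_apply_apply ℝ, h0]; rfl
  rw [← this, hGu]
  simp_rw [real_inner_comm]

end Regularity

/-! ### From `L¹` expansions of the input to uniform expansions of the output. -/

section UniformScore

variable {V : Type*} [MeasurableSpace V] {d : ℕ}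

/-- The family `Q` has densities with respect to `Q θ` whose first-order expansion at `θ` is uniform
over the sample space, with bounded score `s`. -/
structure HasUniformScore (Θ : Set (EuclideanSpace ℝ (Fin d)))
    (Q : EuclideanSpace ℝ (Fin d) → Measure V) (θ : EuclideanSpace ℝ (Fin d))
    (s : V → EuclideanSpace ℝ (Fin d)) : Prop where
  measurable : Measurable s
  bounded : ∃ B, ∀ v, ‖s v‖ ≤ B
  exists_density : ∃ (q : EuclideanSpace ℝ (Fin d) → V → ℝ) (ρ : EuclideanSpace ℝ (Fin d) → ℝ),
    IsDensityFamily Θ Q (Q θ) q ∧ ρ =o[𝓝[Θ] θ] (fun θ' => θ' - θ) ∧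
    ∀ᶠ θ' in 𝓝[Θ] θ, ∀ v, |q θ' v - 1 - ⟪s v, θ' - θ⟫| ≤ ρ θ'

lemma eventually_mul_norm_sub_le (Θ : Set (EuclideanSpace ℝ (Fin d)))
    (θ : EuclideanSpace ℝ (Fin d)) (B : ℝ) : ∀ᶠ θ' in 𝓝[Θ] θ, B * ‖θ' - θ‖ ≤ 1 := by
  have : Tendsto (fun θ' => B * ‖θ' - θ‖) (𝓝[Θ] θ) (𝓝 (B * ‖θ - θ‖)) :=
    ((continuous_const.mul (continuous_id.sub continuous_const).norm).tendsto θ).mono_left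
      nhdsWithin_le_nhds
  rw [sub_self, norm_zero, mul_zero] at this
  filter_upwards [this.eventually_lt_const one_pos] with θ' h using h.le

variable {X : Type*} [MeasurableSpace X]

lemma comp_real_apply {P : Measure X} [IsProbabilityMeasure P] (κ : Kernel X V)
    [IsMarkovKernel κ] {A : Set V} (hA : MeasurableSet A) :
    (κ ∘ₘ P).real A = ∫ x, (κ x).real A ∂P := by
  rw [← integral_indicator_one hA, integral_bind_kernel κ
    (integrable_of_abs_le (measurable_one.indicator hA) (C := 1) fun v => by
      by_cases hv : v ∈ A <;> simp [hv])]
  simp_rw [integral_indicator_one hA]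

/-- A null set of `κ ∘ₘ P` is null for every `κ x`, so `P` and `P'` need not be related. -/
lemma IsLDP.comp_absolutelyContinuous {P P' : Measure X} [IsProbabilityMeasure P] {ε : ℝ}
    {κ : Kernel X V} (hκ : IsLDP ε κ) : κ ∘ₘ P' ≪ κ ∘ₘ P := by
  refine Measure.AbsolutelyContinuous.mk fun A hA h0 => ?_
  rw [Measure.bind_apply hA κ.aemeasurable, lintegral_eq_zero_of_ae_eq_zero]
  refine ae_of_all _ fun x => ?_
  have := hκ.le_comp (P := P) x hA
  rw [h0, mul_zero] at this
  exact le_antisymm this bot_le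

/-- The score is the coordinatewise conditional mean of the input score. The error of the output
expansion is the image of the input remainder under the mechanism, hence bounded by `e^ε` times the
`L¹` norm of that remainder. -/
lemma IsLDP.hasUniformScore {Θ : Set (EuclideanSpace ℝ (Fin d))}
    {P : EuclideanSpace ℝ (Fin d) → Measure X} {μ : Measure X}
    {p : EuclideanSpace ℝ (Fin d) → X → ℝ} {θ : EuclideanSpace ℝ (Fin d)}
    (hP : ∀ θ' ∈ Θ, IsProbabilityMeasure (P θ')) (hp : IsDensityFamily Θ P μ p) (hθ : θ ∈ Θ)
    (hreg : IsRegularAt Θ P μ p θ) {ε : ℝ} {κ : Kernel X V} [IsMarkovKernel κ]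
    (hκ : IsLDP ε κ) :
    ∃ t : V → EuclideanSpace ℝ (Fin d), HasUniformScore Θ (fun θ' => κ ∘ₘ P θ') θ t ∧
      ∀ (u : EuclideanSpace ℝ (Fin d)) (φ : V → ℝ), Measurable φ → ∀ C, (∀ v, |φ v| ≤ C) →
        ∫ v, ⟪u, t v⟫ * φ v ∂(κ ∘ₘ P θ) =
          ∫ x, ⟪u, score Θ p θ x⟫ * ∫ v, φ v ∂(κ x) ∂(P θ) := by
  have hPθ := hP θ hθ
  set J := κ ∘ₘ P θ with hJ
  have hsi : ∀ i, Integrable (fun x => score Θ p θ x i) (P θ) := fun i =>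
    (EuclideanSpace.proj (𝕜 := ℝ) i).integrable_comp hreg.integrable_score
  choose T hTm hTb hTφ using fun i => hκ.exists_posterior_mean (hsi i)
  choose B hB using hTb
  set t : V → EuclideanSpace ℝ (Fin d) := fun v => WithLp.toLp 2 fun i => T i v with ht
  have htm : Measurable t :=
    (WithLp.measurable_toLp 2 (Fin d → ℝ)).comp (measurable_pi_iff.2 hTm)
  have hin : ∀ u v, ⟪u, t v⟫ = ∑ i, u i * T i v := fun u v => by
    simp [PiLp.inner_apply, ht, mul_comm]
  have hins : ∀ u x, ⟪u, score Θ p θ x⟫ = ∑ i, u i * score Θ p θ x i := fun u x => by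
    simp [PiLp.inner_apply, mul_comm]
  have htb : ∃ B, ∀ v, ‖t v‖ ≤ B := by
    refine ⟨√(∑ i, B i ^ 2), fun v => ?_⟩
    rw [EuclideanSpace.norm_eq]
    refine Real.sqrt_le_sqrt (Finset.sum_le_sum fun i _ => ?_)
    exact pow_le_pow_left₀ (norm_nonneg _) (hB i v) 2
  have hrep : ∀ (u : EuclideanSpace ℝ (Fin d)) (φ : V → ℝ), Measurable φ → ∀ C, (∀ v, |φ v| ≤ C) →
        ∫ v, ⟪u, t v⟫ * φ v ∂J = ∫ x, ⟪u, score Θ p θ x⟫ * ∫ v, φ v ∂(κ x) ∂(P θ) := by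
    intro u φ hφ C hC
    have iT : ∀ i, Integrable (fun v => T i v * φ v) J := fun i =>
      (integrable_of_abs_le (hTm i) (hB i)).mul_bdd hφ.aestronglyMeasurable (ae_of_all _ hC)
    have iS : ∀ i, Integrable (fun x => score Θ p θ x i * ∫ v, φ v ∂(κ x)) (P θ) := fun i =>
      (hsi i).mul_bdd (measurable_integral_kernel κ hφ).aestronglyMeasurable
        (ae_of_all _ (abs_integral_kernel_le κ hC))
    simp_rw [hin, hins, Finset.sum_mul, mul_assoc]
    rw [integral_finsetSum _ fun i _ => (iT i).const_mul _,
      integral_finsetSum _ fun i _ => (iS i).const_mul _]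
    simp_rw [integral_const_mul]
    exact Finset.sum_congr rfl fun i _ => by rw [hTφ i φ hφ C hC]
  refine ⟨t, ⟨htm, htb, ?_⟩, hrep⟩
  obtain ⟨B, hB⟩ := htb
  set ρ : EuclideanSpace ℝ (Fin d) → ℝ :=
    fun θ' => Real.exp ε * ∫ x, |remainder Θ p θ θ' x| ∂μ with hρ
  have hρ0 : ∀ θ', 0 ≤ ρ θ' := fun θ' =>
    mul_nonneg (Real.exp_pos ε).le (integral_nonneg fun _ => abs_nonneg _)
  set D : EuclideanSpace ℝ (Fin d) → V → ℝ :=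
    fun θ' v => ((κ ∘ₘ P θ').rnDeriv J v).toReal with hD
  set y : EuclideanSpace ℝ (Fin d) → V → ℝ := fun θ' v => 1 + ⟪t v, θ' - θ⟫ with hy
  have hDm : ∀ θ', Measurable (D θ') := fun θ' => (Measure.measurable_rnDeriv _ _).ennreal_toReal
  have hym : ∀ θ', Measurable (y θ') := fun θ' => (htm.inner measurable_const).const_add 1
  have hyint : ∀ θ', Integrable (fun v => ⟪t v, θ' - θ⟫) J := fun θ' =>
    integrable_of_abs_le (htm.inner measurable_const) (C := B * ‖θ' - θ‖) fun v =>
      (abs_real_inner_le_norm _ _).trans (mul_le_mul_of_nonneg_right (hB v) (norm_nonneg _))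
  have hae : ∀ θ' ∈ Θ, ∀ᵐ v ∂J, |D θ' v - y θ' v| ≤ ρ θ' := fun θ' hθ' => by
    have hPθ' := hP θ' hθ'
    have iD : Integrable (D θ') J := Measure.integrable_toReal_rnDeriv
    have iy : Integrable (y θ') J := (integrable_const 1).add (hyint θ')
    refine ae_abs_le_of_setIntegral (iD.sub iy) fun A hA => ?_
    have hkm : Measurable fun x => (κ x).real A := (κ.measurable_coe hA).ennreal_toReal
    have hk1 : ∀ x, |(κ x).real A| ≤ 1 := fun x => by
      rw [abs_of_nonneg measureReal_nonneg]; exact measureReal_le_one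
    have e1 : ∫ v in A, D θ' v ∂J = (κ ∘ₘ P θ').real A :=
      Measure.setIntegral_toReal_rnDeriv hκ.comp_absolutelyContinuous A
    have e2 : ∫ v in A, ⟪t v, θ' - θ⟫ ∂J =
        ∫ x, ⟪score Θ p θ x, θ' - θ⟫ * (κ x).real A ∂(P θ) := by
      have := hrep (θ' - θ) (A.indicator 1) (measurable_one.indicator hA) 1 fun v => by
        by_cases hv : v ∈ A <;> simp [hv]
      simp_rw [integral_indicator_one hA, fun w => real_inner_comm w (θ' - θ)] at this
      rw [← this, ← integral_indicator hA]
      refine integral_congr_ae (ae_of_all _ fun v => ?_)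
      by_cases hv : v ∈ A <;> simp [hv]
    have e3 : ∫ v in A, (D θ' - y θ') v ∂J = ∫ x, remainder Θ p θ θ' x * (κ x).real A ∂μ := by
      rw [hreg.integral_remainder_mul hP hp hθ hθ' hkm hk1, ← comp_real_apply κ hA,
        ← comp_real_apply κ hA, ← e1, ← e2]
      simp only [Pi.sub_apply]
      rw [integral_sub iD.integrableOn iy.integrableOn, hy,
        integral_add (integrable_const _) (hyint θ').integrableOn]
      simp only [setIntegral_const, smul_eq_mul, mul_one]
      ring
    rw [e3]
    exact hκ.abs_integral_mul_le (hreg.integrable_remainder hP hp hθ hθ') hA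
  -- A version of the density `D` with the error clipped to `±ρ` and the result made nonnegative, so
  -- that both properties hold everywhere.
  set q : EuclideanSpace ℝ (Fin d) → V → ℝ := fun θ' v =>
    max 0 (y θ' v + max (-ρ θ') (min (ρ θ') (D θ' v - y θ' v))) with hq
  have hqm : ∀ θ', Measurable (q θ') := fun θ' => measurable_const.max
    ((hym θ').add (measurable_const.max (measurable_const.min ((hDm θ').sub (hym θ')))))
  refine ⟨q, ρ, ⟨fun θ' _ => hqm θ', fun _ _ _ => le_max_left _ _, fun θ' hθ' => ?_⟩,
    hreg.isLittleO.const_mul_left _, ?_⟩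
  · have hPθ' := hP θ' hθ'
    rw [← Measure.withDensity_rnDeriv_eq (κ ∘ₘ P θ') J hκ.comp_absolutelyContinuous]
    refine withDensity_congr_ae ?_
    filter_upwards [hae θ' hθ', Measure.rnDeriv_lt_top (κ ∘ₘ P θ') J] with v hv hlt
    have h0 : 0 ≤ D θ' v := ENNReal.toReal_nonneg
    simp only [hq]
    rw [min_eq_right (abs_le.1 hv).2, max_eq_right (abs_le.1 hv).1, add_sub_cancel,
      max_eq_right h0, hD, ENNReal.ofReal_toReal hlt.ne]
  -- Near `θ` the linear part `y` is nonnegative, so the cut at `0` does not increase the distance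
  -- to `y` beyond `ρ`.
  · filter_upwards [eventually_mul_norm_sub_le Θ θ B] with θ' hθ' v
    have hin1 : |⟪t v, θ' - θ⟫| ≤ 1 := (abs_real_inner_le_norm _ _).trans
      ((mul_le_mul_of_nonneg_right (hB v) (norm_nonneg _)).trans hθ')
    have hy0 : 0 ≤ y θ' v := by
      have := (abs_le.1 hin1).1
      simp only [hy]; linarith
    have hcl : |max (-ρ θ') (min (ρ θ') (D θ' v - y θ' v))| ≤ ρ θ' :=
      abs_le.2 ⟨le_max_left _ _, max_le (by linarith [hρ0 θ']) (min_le_left _ _)⟩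
    have e : q θ' v - 1 - ⟪t v, θ' - θ⟫ = q θ' v - y θ' v := by simp only [hy]; ring
    rw [e]
    set z := max (-ρ θ') (min (ρ θ') (D θ' v - y θ' v))
    simp only [hq]
    have := abs_le.1 hcl
    rcases le_total 0 (y θ' v + z) with h | h
    · rw [max_eq_right h, add_sub_cancel_left]; exact hcl
    · rw [max_eq_left h]; exact abs_le.2 ⟨by linarith, by linarith⟩

end UniformScore

/-! ### Products of uniform expansions and one more round of the mechanism. -/

section Composition

variable {V W : Type*} [MeasurableSpace V] [MeasurableSpace W] {d : ℕ}
  {Θ : Set (EuclideanSpace ℝ (Fin d))} {θ : EuclideanSpace ℝ (Fin d)}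

lemma map_withDensity_of_leftInverse (Q : Measure V) {f : V → W} {g : W → V} (hf : Measurable f)
    (hg : Measurable g) (hgf : Function.LeftInverse g f) {h : V → ℝ≥0∞} (hh : Measurable h) :
    (Q.withDensity h).map f = (Q.map f).withDensity (h ∘ g) := by
  refine Measure.ext_of_lintegral _ fun F hF => ?_
  have hFf : Measurable fun v => F (f v) := hF.comp hf
  rw [lintegral_map hF hf, lintegral_withDensity_eq_lintegral_mul _ hh hFf,
    lintegral_withDensity_eq_lintegral_mul _ (hh.comp hg) hF,
    lintegral_map ((hh.comp hg).mul hF) hf]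
  simp [hgf _]

lemma HasUniformScore.map {Q : EuclideanSpace ℝ (Fin d) → Measure V}
    {s : V → EuclideanSpace ℝ (Fin d)} (h : HasUniformScore Θ Q θ s) {f : V → W} {g : W → V}
    (hf : Measurable f) (hg : Measurable g) (hgf : Function.LeftInverse g f) :
    HasUniformScore Θ (fun θ' => (Q θ').map f) θ (s ∘ g) := by
  obtain ⟨hm, ⟨B, hB⟩, q, ρ, hq, hρ, hqρ⟩ := h
  refine ⟨hm.comp hg, ⟨B, fun v => hB (g v)⟩, fun θ' => q θ' ∘ g, ρ,
    ⟨fun θ' h => (hq.measurable θ' h).comp hg, fun θ' h v => hq.nonneg θ' h _, fun θ' h => ?_⟩, hρ,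
    hqρ.mono fun θ' h v => h (g v)⟩
  rw [hq.withDensity_eq θ' h,
    map_withDensity_of_leftInverse _ hf hg hgf (hq.measurable θ' h).ennreal_ofReal]
  rfl

/-- The terms `α`, `αb`, `αβ` cost `r₁` each, `β` and `aβ` cost `r₂` each, and `ab` is kept because
it is of second order. -/
lemma abs_mul_expansion_le {a b α β r₁ r₂ : ℝ} (ha : |a| ≤ 1) (hb : |b| ≤ 1) (hα : |α| ≤ r₁)
    (hβ : |β| ≤ r₂) (hr₂ : r₂ ≤ 1) :
    |(1 + a + α) * (1 + b + β) - 1 - (a + b)| ≤ 3 * r₁ + 2 * r₂ + |a| * |b| := by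
  have e : (1 + a + α) * (1 + b + β) - 1 - (a + b) =
      α + β + a * b + a * β + α * b + α * β := by ring
  have h1 : |a * β| ≤ r₂ := by
    rw [abs_mul]; nlinarith [abs_nonneg a, abs_nonneg β]
  have h2 : |α * b| ≤ r₁ := by
    rw [abs_mul]; nlinarith [abs_nonneg b, abs_nonneg α]
  have h3 : |α * β| ≤ r₁ := by
    rw [abs_mul]; nlinarith [abs_nonneg β, abs_nonneg α]
  have h4 := abs_mul a b
  rw [e, abs_le]
  rw [abs_le] at hα hβ h1 h2 h3
  have h5 := abs_le.1 h4.le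
  constructor <;> linarith [h5.1, h5.2]

/-- Uniform differentiability of a family whose densities are products. -/
lemma HasUniformScore.mul {Q : EuclideanSpace ℝ (Fin d) → Measure W}
    {J A : EuclideanSpace ℝ (Fin d) → Measure V} {s : W → EuclideanSpace ℝ (Fin d)}
    {t : V → EuclideanSpace ℝ (Fin d)} (hs : HasUniformScore Θ Q θ s)
    (ht : HasUniformScore Θ J θ t) {f : V → W} (hf : Measurable f) (hA0 : A θ = J θ)
    (hA : ∀ q, IsDensityFamily Θ Q (Q θ) q → ∀ θ' ∈ Θ,
      A θ' = (J θ').withDensity fun v => ENNReal.ofReal (q θ' (f v))) :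
    HasUniformScore Θ A θ (fun v => s (f v) + t v) := by
  obtain ⟨hsm, ⟨B₁, hB₁⟩, q, ρ₁, hq, hρ₁, hqρ⟩ := hs
  obtain ⟨htm, ⟨B₂, hB₂⟩, r, ρ₂, hr, hρ₂, hrρ⟩ := ht
  refine ⟨(hsm.comp hf).add htm, ⟨B₁ + B₂, fun v => (norm_add_le _ _).trans
    (add_le_add (hB₁ _) (hB₂ _))⟩, fun θ' v => q θ' (f v) * r θ' v,
    fun θ' => 3 * ρ₁ θ' + 2 * ρ₂ θ' + (B₁ * ‖θ' - θ‖) * (B₂ * ‖θ' - θ‖),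
    ⟨fun θ' h => ((hq.measurable θ' h).comp hf).mul (hr.measurable θ' h),
      fun θ' h v => mul_nonneg (hq.nonneg θ' h _) (hr.nonneg θ' h _), fun θ' h => ?_⟩, ?_, ?_⟩
  · have hqf : Measurable fun v => q θ' (f v) := (hq.measurable θ' h).comp hf
    rw [hA q hq θ' h, hA0, hr.withDensity_eq θ' h,
      ← withDensity_mul _ (hr.measurable θ' h).ennreal_ofReal hqf.ennreal_ofReal]
    congr 1
    ext v
    rw [Pi.mul_apply, mul_comm, ← ENNReal.ofReal_mul (hq.nonneg θ' h _)]
  · refine ((hρ₁.const_mul_left 3).add (hρ₂.const_mul_left 2)).add ?_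
    have h0 : Tendsto (fun θ' => B₁ * ‖θ' - θ‖) (𝓝[Θ] θ) (𝓝 0) := by
      have : Tendsto (fun θ' => B₁ * ‖θ' - θ‖) (𝓝[Θ] θ) (𝓝 (B₁ * ‖θ - θ‖)) :=
        ((continuous_const.mul (continuous_id.sub continuous_const).norm).tendsto θ).mono_left
          nhdsWithin_le_nhds
      simpa using this
    have h1 := ((isLittleO_one_iff ℝ).2 h0).mul_isBigO
      ((isBigO_refl (fun θ' => ‖θ' - θ‖) (𝓝[Θ] θ)).const_mul_left B₂)
    simp only [one_mul] at h1
    exact isLittleO_norm_right.1 h1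
  -- `ρ₂ ≤ ‖θ' - θ‖ ≤ 1` near `θ` supplies the hypothesis `r₂ ≤ 1`.
  · filter_upwards [hqρ, hrρ, hρ₂.bound one_pos, eventually_mul_norm_sub_le Θ θ 1,
      eventually_mul_norm_sub_le Θ θ B₁, eventually_mul_norm_sub_le Θ θ B₂] with
      θ' h1 h2 h3 h4 h5 h6 v
    have ha : |⟪s (f v), θ' - θ⟫| ≤ B₁ * ‖θ' - θ‖ := (abs_real_inner_le_norm _ _).trans
      (mul_le_mul_of_nonneg_right (hB₁ _) (norm_nonneg _))
    have hb : |⟪t v, θ' - θ⟫| ≤ B₂ * ‖θ' - θ‖ := (abs_real_inner_le_norm _ _).trans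
      (mul_le_mul_of_nonneg_right (hB₂ _) (norm_nonneg _))
    have := abs_mul_expansion_le (ha.trans h5) (hb.trans h6) (h1 (f v)) (h2 v)
      ((le_abs_self _).trans (h3.trans h4))
    have e1 : 1 + ⟪s (f v), θ' - θ⟫ + (q θ' (f v) - 1 - ⟪s (f v), θ' - θ⟫) = q θ' (f v) := by ring
    have e2 : 1 + ⟪t v, θ' - θ⟫ + (r θ' v - 1 - ⟪t v, θ' - θ⟫) = r θ' v := by ring
    rw [e1, e2] at this
    rw [inner_add_left]
    refine this.trans (add_le_add_right (mul_le_mul ha hb (abs_nonneg _)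
      ((abs_nonneg _).trans ha)) _)

variable {X Z : Type*} [MeasurableSpace X] [MeasurableSpace Z]

/-- Publishing an independent variable along with a locally private output is locally private. -/
lemma IsLDP.const_compProd {ε : ℝ} (ν : Measure W) [IsProbabilityMeasure ν]
    {K : Kernel (X × W) Z} [IsMarkovKernel K] (hK : ∀ w, IsLDP ε (K.sectL w)) :
    IsLDP ε (Kernel.const X ν ⊗ₖ K) := by
  intro x x' A hA
  rw [Kernel.compProd_apply hA, Kernel.compProd_apply hA, Kernel.const_apply, Kernel.const_apply,
    ← lintegral_const_mul _ (Kernel.measurable_kernel_prodMk_left'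
      (η := K) hA x')]
  refine lintegral_mono fun w => ?_
  have := hK w x x' (Prod.mk w ⁻¹' A) (measurable_prodMk_left hA)
  rwa [Kernel.sectL_apply, Kernel.sectL_apply] at this

lemma lintegral_const_compProd_comp {ν : Measure W} [IsProbabilityMeasure ν]
    {K : Kernel (X × W) Z} [IsMarkovKernel K] {P : Measure X} {F : W × Z → ℝ≥0∞}
    (hF : Measurable F) :
    ∫⁻ v, F v ∂((Kernel.const X ν ⊗ₖ K) ∘ₘ P) =
      ∫⁻ x, ∫⁻ w, ∫⁻ z, F (w, z) ∂(K (x, w)) ∂ν ∂P := by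
  rw [Measure.lintegral_bind (Kernel.aemeasurable _) hF.aemeasurable]
  simp_rw [Kernel.lintegral_compProd _ _ _ hF, Kernel.const_apply]

/-- `K` sees only the value of `w`, not its law, so reweighting that law reweights the joint output
by the same function of its first coordinate. This separates the two ways in which the output law
depends on the parameter. -/
lemma const_withDensity_compProd_comp {ν : Measure W} [IsProbabilityMeasure ν]
    {K : Kernel (X × W) Z} [IsMarkovKernel K] {P : Measure X} {h : W → ℝ≥0∞} (hh : Measurable h)
    [IsProbabilityMeasure (ν.withDensity h)] :
    (Kernel.const X (ν.withDensity h) ⊗ₖ K) ∘ₘ P =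
      ((Kernel.const X ν ⊗ₖ K) ∘ₘ P).withDensity (h ∘ Prod.fst) := by
  refine Measure.ext_of_lintegral _ fun F hF => ?_
  rw [lintegral_withDensity_eq_lintegral_mul _ (hh.comp measurable_fst) hF,
    lintegral_const_compProd_comp hF,
    lintegral_const_compProd_comp ((hh.comp measurable_fst).mul hF)]
  refine lintegral_congr fun x => ?_
  have hm : Measurable fun w => ∫⁻ z, F (w, z) ∂(K (x, w)) := by
    exact Measurable.lintegral_kernel_prod_right' (κ := K.comap (fun w => (x, w))
      measurable_prodMk_left) hF
  rw [lintegral_withDensity_eq_lintegral_mul _ hh hm]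
  refine lintegral_congr fun w => ?_
  simp only [Pi.mul_apply, Function.comp_apply]
  exact (lintegral_const_mul _ (hF.comp measurable_prodMk_left)).symm

lemma lintegral_sq_add_eq {J : Measure V} [IsFiniteMeasure J] {a b : V → ℝ} (ha : Measurable a)
    (hb : Measurable b) {A B : ℝ} (hA : ∀ v, |a v| ≤ A) (hB : ∀ v, |b v| ≤ B)
    (hab : ∫ v, a v * b v ∂J = 0) :
    ∫⁻ v, ENNReal.ofReal ((a v + b v) ^ 2) ∂J =
      ∫⁻ v, ENNReal.ofReal (a v ^ 2) ∂J + ∫⁻ v, ENNReal.ofReal (b v ^ 2) ∂J := by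
  have ia : Integrable a J := integrable_of_abs_le ha hA
  have ib : Integrable b J := integrable_of_abs_le hb hB
  have ia2 : Integrable (fun v => a v ^ 2) J := by
    simp_rw [sq]; exact ia.mul_bdd ha.aestronglyMeasurable (ae_of_all _ hA)
  have ib2 : Integrable (fun v => b v ^ 2) J := by
    simp_rw [sq]; exact ib.mul_bdd hb.aestronglyMeasurable (ae_of_all _ hB)
  have iab : Integrable (fun v => a v * b v) J :=
    ia.mul_bdd hb.aestronglyMeasurable (ae_of_all _ hB)
  have e : ∀ v, (a v + b v) ^ 2 = 1 * a v ^ 2 + 2 * (a v * b v) + 1 * b v ^ 2 := fun v => by ring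
  rw [← ofReal_integral_eq_lintegral_ofReal ia2 (ae_of_all _ fun _ => sq_nonneg _),
    ← ofReal_integral_eq_lintegral_ofReal ib2 (ae_of_all _ fun _ => sq_nonneg _),
    ← ofReal_integral_eq_lintegral_ofReal _ (ae_of_all _ fun _ => sq_nonneg _),
    ← ENNReal.ofReal_add (integral_nonneg fun _ => sq_nonneg _)
      (integral_nonneg fun _ => sq_nonneg _)]
  · simp_rw [e]
    rw [integral_linear_comb ia2 iab ib2, hab]
    simp
  · simp_rw [e]
    exact integrable_linear_comb ia2 iab ib2 _ _ _

/-- One more round of a locally private mechanism: uniform differentiability is kept, and the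
Fisher information grows by at most `Υ_ε I_X(θ)`. -/
lemma HasUniformScore.const_compProd {P : EuclideanSpace ℝ (Fin d) → Measure X} {μ : Measure X}
    {p : EuclideanSpace ℝ (Fin d) → X → ℝ} (hP : ∀ θ' ∈ Θ, IsProbabilityMeasure (P θ'))
    (hp : IsDensityFamily Θ P μ p) (hθ : θ ∈ Θ) (hΘ : UniqueDiffWithinAt ℝ Θ θ)
    (hreg : IsRegularAt Θ P μ p θ) {ε : ℝ} {K : Kernel (X × W) Z} [IsMarkovKernel K]
    (hK : ∀ w, IsLDP ε (K.sectL w)) {Q : EuclideanSpace ℝ (Fin d) → Measure W}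
    (hQ : ∀ θ' ∈ Θ, IsProbabilityMeasure (Q θ')) {s : W → EuclideanSpace ℝ (Fin d)}
    (hs : HasUniformScore Θ Q θ s) :
    ∃ s' : W × Z → EuclideanSpace ℝ (Fin d),
      HasUniformScore Θ (fun θ' => (Kernel.const X (Q θ') ⊗ₖ K) ∘ₘ P θ') θ s' ∧
      ∀ u, ∫⁻ v, ENNReal.ofReal (⟪u, s' v⟫ ^ 2) ∂((Kernel.const X (Q θ) ⊗ₖ K) ∘ₘ P θ) ≤
        ∫⁻ w, ENNReal.ofReal (⟪u, s w⟫ ^ 2) ∂(Q θ) +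
          ENNReal.ofReal (Upsilon ε) * fisherForm Θ P p θ u := by
  have hPθ := hP θ hθ
  have hQθ := hQ θ hθ
  -- The law of the past is frozen at `θ`; its variation enters only as the density factor `q θ'
  -- v.1`.
  have hκ := IsLDP.const_compProd (Q θ) hK
  obtain ⟨t, ht, hrep⟩ := hκ.hasUniformScore hP hp hθ hreg
  refine ⟨fun v => s v.1 + t v, hs.mul ht measurable_fst rfl fun q hq θ' h => ?_, fun u => ?_⟩
  · have hQ' := hQ θ' h
    have e := hq.withDensity_eq θ' h
    rw [e] at hQ' ⊢
    exact const_withDensity_compProd_comp (hq.measurable θ' h).ennreal_ofReal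
  · obtain ⟨B₁, hB₁⟩ := hs.bounded
    obtain ⟨B₂, hB₂⟩ := ht.bounded
    have hb1 : ∀ w, |⟪u, s w⟫| ≤ ‖u‖ * B₁ := fun w => (abs_real_inner_le_norm _ _).trans
      (mul_le_mul_of_nonneg_left (hB₁ w) (norm_nonneg _))
    have hb2 : ∀ v, |⟪u, t v⟫| ≤ ‖u‖ * B₂ := fun w => (abs_real_inner_le_norm _ _).trans
      (mul_le_mul_of_nonneg_left (hB₂ w) (norm_nonneg _))
    have hm1 : Measurable fun w => ⟪u, s w⟫ := measurable_const.inner hs.measurable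
    have hm2 : Measurable fun v => ⟪u, t v⟫ := measurable_const.inner ht.measurable
    -- The past is independent of the new sample, so its conditional mean given `x` is constant, and
    -- the centred input score annihilates it in `hcross`.
    have hmean : ∀ x, ∫ v, ⟪u, s v.1⟫ ∂((Kernel.const X (Q θ) ⊗ₖ K) x) = ∫ w, ⟪u, s w⟫ ∂(Q θ) :=
      fun x => by
      have e : ((Kernel.const X (Q θ) ⊗ₖ K) x).map Prod.fst = Q θ := by
        rw [← Kernel.fst_apply, Kernel.fst_compProd, Kernel.const_apply]
      conv_rhs => rw [← e]
      rw [integral_map measurable_fst.aemeasurable hm1.aestronglyMeasurable]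
    have hcross : ∫ v, ⟪u, s v.1⟫ * ⟪u, t v⟫ ∂((Kernel.const X (Q θ) ⊗ₖ K) ∘ₘ P θ) = 0 := by
      have := hrep u (fun v => ⟪u, s v.1⟫) (hm1.comp measurable_fst) _ fun v => hb1 v.1
      simp_rw [hmean] at this
      rw [integral_mul_const, hreg.integral_inner_score hP hp hθ hΘ, zero_mul] at this
      rw [← this]
      exact integral_congr_ae (ae_of_all _ fun v => mul_comm _ _)
    have hi : Integrable (fun x => ⟪u, score Θ p θ x⟫) (P θ) :=
      hreg.integrable_score.const_inner u
    have hcontr := hκ.lintegral_sq_posterior_mean_le hi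
      (hreg.integral_inner_score hP hp hθ hΘ u) hm2 hb2
      (hrep u _ hm2 _ hb2)
    simp_rw [inner_add_right]
    have hm1' : Measurable fun v : W × Z => ⟪u, s v.1⟫ := hm1.comp measurable_fst
    rw [lintegral_sq_add_eq hm1' hm2 (fun v => hb1 v.1) hb2 hcross]
    refine add_le_add (le_of_eq ?_) hcontr
    rw [lintegral_const_compProd_comp (hm1'.pow_const 2).ennreal_ofReal]
    simp

end Composition

/-! ### Induction over the rounds. -/

section Sequential

variable {X Z : Type*} [MeasurableSpace X] [MeasurableSpace Z]

instance isProbabilityMeasure_outputLaw {n : ℕ} (K : (i : Fin n) → Kernel (X × (Fin i → Z)) Z)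
    [∀ i, IsMarkovKernel (K i)] (P : Measure X) [IsProbabilityMeasure P] :
    IsProbabilityMeasure (outputLaw K P) := by
  unfold outputLaw; infer_instance

lemma outputLaw_zero (K : (i : Fin 0) → Kernel (X × (Fin i → Z)) Z) (P : Measure X)
    [IsProbabilityMeasure P] : outputLaw K P = Measure.dirac Fin.elim0 := by
  simp [outputLaw, seqChannel]

/-- The last sample is independent of the previous outputs, so one round of the sequential mechanism
is a single channel applied to it, which also publishes the previous outputs. -/
lemma outputLaw_succ {n : ℕ} (K : (i : Fin (n + 1)) → Kernel (X × (Fin i → Z)) Z)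
    [∀ i, IsMarkovKernel (K i)] (P : Measure X) [IsProbabilityMeasure P] :
    outputLaw K P = (((Kernel.const X (outputLaw (fun i : Fin n => K i.castSucc) P) :
      Kernel X (Fin n → Z)) ⊗ₖ (K (Fin.last n) : Kernel (X × (Fin n → Z)) Z)) ∘ₘ P).map
        (snocOutput Z n) := by
  have hM0 : IsMarkovKernel (seqChannel n fun i : Fin n => K i.castSucc) := inferInstance
  have hM1 : IsMarkovKernel (K (Fin.last n)) := inferInstance
  have hprob : IsProbabilityMeasure (outputLaw (fun i : Fin n => K i.castSucc) P) := inferInstance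
  refine Measure.ext_of_lintegral _ fun f hf => ?_
  have hfs : Measurable (f ∘ snocOutput Z n) := hf.comp (measurable_snocOutput Z n)
  rw [lintegral_map hf (measurable_snocOutput Z n)]
  refine Eq.trans ?_ (lintegral_const_compProd_comp (W := Fin n → Z) (K := K (Fin.last n)) hfs).symm
  set F : X × (Fin n → Z) → ℝ≥0∞ :=
    fun y => ∫⁻ w, f (snocOutput Z n (y.2, w)) ∂(K (Fin.last n) y) with hF
  have hFm : Measurable F := by
    refine Measurable.lintegral_kernel_prod_right' (κ := K (Fin.last n))
      (f := fun y : (X × (Fin n → Z)) × Z => f (snocOutput Z n (y.1.2, y.2))) ?_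
    exact hfs.comp ((measurable_snd.comp measurable_fst).prodMk measurable_snd)
  have hstep : ∀ x : Fin (n + 1) → X, ∫⁻ z, f z ∂(seqChannel (n + 1) K x) =
      ∫⁻ z, F (x (Fin.last n), z) ∂(seqChannel n (fun i => K i.castSucc)
        fun j => x j.castSucc) := fun x => by
    rw [seqChannel, Kernel.map_apply _ (measurable_snocOutput Z n),
      lintegral_map hf (measurable_snocOutput Z n)]
    exact Kernel.lintegral_compProd _ _ _ hfs
  unfold outputLaw
  rw [Measure.lintegral_bind (Kernel.aemeasurable _) hf.aemeasurable]
  simp_rw [hstep]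
  -- Splits the product measure into the last sample and the earlier ones.
  have hmp := measurePreserving_piFinSuccAbove (fun _ : Fin (n + 1) => P) (Fin.last n)
  set G : X × (Fin n → X) → ℝ≥0∞ :=
    fun y => ∫⁻ z, F (y.1, z) ∂(seqChannel n (fun i => K i.castSucc) y.2) with hG
  have hGm : Measurable G := by
    refine Measurable.lintegral_kernel_prod_right' (κ := (seqChannel n
      (fun i => K i.castSucc)).comap (Prod.snd : X × (Fin n → X) → _) measurable_snd)
      (f := fun y : (X × (Fin n → X)) × (Fin n → Z) => F (y.1.1, y.2)) ?_
    exact hFm.comp ((measurable_fst.comp measurable_fst).prodMk measurable_snd)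
  have h1 := hmp.lintegral_comp hGm
  have h2 : ∀ x : Fin (n + 1) → X,
      G (MeasurableEquiv.piFinSuccAbove (fun _ => X) (Fin.last n) x) =
      ∫⁻ z, F (x (Fin.last n), z) ∂(seqChannel n (fun i => K i.castSucc)
        fun j => x j.castSucc) := fun x => by
    simp only [hG, MeasurableEquiv.piFinSuccAbove_apply, Fin.insertNthEquiv_symm_apply]
    have : (Fin.last n).removeNth x = fun j => x j.castSucc := by
      ext j; simp [Fin.removeNth]
    rw [this]
  simp_rw [h2] at h1
  rw [h1, lintegral_prod _ hGm.aemeasurable]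
  refine lintegral_congr fun a => ?_
  exact (Measure.lintegral_bind (Kernel.aemeasurable _)
    (hFm.comp measurable_prodMk_left).aemeasurable).symm

/-- The laws of the outputs of a sequentially interactive locally private mechanism are uniformly
differentiable, and the Fisher information obeys the bound. -/
theorem exists_hasUniformScore_outputLaw {d : ℕ} {Θ : Set (EuclideanSpace ℝ (Fin d))}
    {θ : EuclideanSpace ℝ (Fin d)} {P : EuclideanSpace ℝ (Fin d) → Measure X} {μ : Measure X}
    {p : EuclideanSpace ℝ (Fin d) → X → ℝ} (hP : ∀ θ' ∈ Θ, IsProbabilityMeasure (P θ'))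
    (hp : IsDensityFamily Θ P μ p) (hθ : θ ∈ Θ) (hΘ : UniqueDiffWithinAt ℝ Θ θ)
    (hreg : IsRegularAt Θ P μ p θ) {ε : ℝ} {n : ℕ} (K : (i : Fin n) → Kernel (X × (Fin i → Z)) Z)
    [∀ i, IsMarkovKernel (K i)] (hK : ∀ (i : Fin n) (z : Fin i → Z), IsLDP ε ((K i).sectL z)) :
    ∃ s : (Fin n → Z) → EuclideanSpace ℝ (Fin d),
      HasUniformScore Θ (fun θ' => outputLaw K (P θ')) θ s ∧
      ∀ u, ∫⁻ z, ENNReal.ofReal (⟪u, s z⟫ ^ 2) ∂(outputLaw K (P θ)) ≤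
        ENNReal.ofReal (n * Upsilon ε) * fisherForm Θ P p θ u := by
  induction n with
  | zero =>
    -- Without samples the output law is a Dirac mass free of the parameter: density `1`, score `0`.
    refine ⟨fun _ => 0, ⟨measurable_const, ⟨0, fun _ => by simp⟩, fun _ _ => 1, fun _ => 0,
      ⟨fun _ _ => measurable_const, fun _ _ _ => zero_le_one, fun θ' h => ?_⟩,
      isLittleO_zero _ _, Eventually.of_forall fun _ _ => by simp⟩, fun u => by simp⟩
    have := hP θ hθ
    have := hP θ' h
    simp only [outputLaw_zero, ENNReal.ofReal_one]
    exact withDensity_one.symm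
  | succ n ih =>
    obtain ⟨s, hs, hsI⟩ := ih (fun i : Fin n => K i.castSucc) fun i z => hK i.castSucc z
    have hM : IsMarkovKernel (K (Fin.last n)) := inferInstance
    have hQ : ∀ θ' ∈ Θ,
        IsProbabilityMeasure (outputLaw (fun i : Fin n => K i.castSucc) (P θ')) := fun θ' h => by
      have := hP θ' h
      infer_instance
    obtain ⟨s', hs', hsI'⟩ := HasUniformScore.const_compProd (K := K (Fin.last n)) hP hp hθ hΘ hreg
      (hK (Fin.last n)) hQ hs
    set g : (Fin (n + 1) → Z) → (Fin n → Z) × Z := fun z => (fun j => z j.castSucc, z (Fin.last n))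
    have hg : Measurable g := (measurable_pi_lambda _ fun j => measurable_pi_apply _).prodMk
      (measurable_pi_apply _)
    have hgs : Function.LeftInverse g (snocOutput Z n) := fun y => by
      simp [g, snocOutput]
    have hmap := hs'.map (measurable_snocOutput Z n) hg hgs
    refine ⟨s' ∘ g, ?_, fun u => ?_⟩
    · obtain ⟨h1, h2, q, ρ, h3, h4, h5⟩ := hmap
      refine ⟨h1, h2, q, ρ, ⟨h3.measurable, h3.nonneg, fun θ' h => ?_⟩, h4, h5⟩
      have := hP θ' h
      have := hP θ hθ
      simp only [outputLaw_succ]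
      exact h3.withDensity_eq θ' h
    · have := hP θ hθ
      rw [outputLaw_succ, lintegral_map ((measurable_const.inner (hs'.measurable.comp hg)).pow_const
        2).ennreal_ofReal (measurable_snocOutput Z n)]
      simp only [Function.comp_apply, hgs _]
      refine (hsI' u).trans ((add_le_add_left (hsI u) _).trans_eq ?_)
      rw [← add_mul, ← ENNReal.ofReal_add (mul_nonneg n.cast_nonneg (Upsilon_nonneg ε))
        (Upsilon_nonneg ε)]
      congr 2
      push_cast
      ring

end Sequential

/-! ### Independence of the choice of densities. -/

section ArbitraryDensities

variable {V : Type*} {d : ℕ} {Θ : Set (EuclideanSpace ℝ (Fin d))}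
  {θ : EuclideanSpace ℝ (Fin d)} {s : V → EuclideanSpace ℝ (Fin d)}
  {q : EuclideanSpace ℝ (Fin d) → V → ℝ}
  {ρ : EuclideanSpace ℝ (Fin d) → ℝ}

lemma hasFDerivWithinAt_of_uniform (hθ : θ ∈ Θ)
    (hρ : ρ =o[𝓝[Θ] θ] (fun θ' => θ' - θ))
    (hq : ∀ᶠ θ' in 𝓝[Θ] θ, ∀ v, |q θ' v - 1 - ⟪s v, θ' - θ⟫| ≤ ρ θ') (v : V) :
    q θ v = 1 ∧ HasFDerivWithinAt (fun θ' => q θ' v) (innerSL ℝ (s v)) Θ θ := by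
  have h1 : q θ v = 1 := by
    have h2 := mem_of_mem_nhdsWithin hθ hq v
    -- At `θ' = θ` the little-o bound reads `|ρ θ| ≤ 0`, which forces `q θ v = 1`.
    have h3 := mem_of_mem_nhdsWithin hθ (hρ.bound one_pos)
    simp only [Set.mem_ofPred_eq, sub_self, norm_zero, mul_zero, norm_le_zero_iff] at h3
    simp only [sub_self, inner_zero_right, sub_zero, h3] at h2
    exact sub_eq_zero.1 (abs_eq_zero.1 (le_antisymm h2 (abs_nonneg _)))
  refine ⟨h1, ?_⟩
  rw [hasFDerivWithinAt_iff_isLittleO]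
  refine IsBigO.trans_isLittleO (IsBigO.of_bound 1 ?_) hρ
  filter_upwards [hq] with θ' h
  rw [h1, one_mul, innerSL_apply_apply, Real.norm_eq_abs]
  exact (h v).trans (le_abs_self _)

variable [MeasurableSpace V] {Q : EuclideanSpace ℝ (Fin d) → Measure V} {ν : Measure V}
  {q' : EuclideanSpace ℝ (Fin d) → V → ℝ}

/-- Chain rule for densities, `dQ_θ'/dν = dQ_θ/dν · dQ_θ'/dQ_θ`; σ-finiteness makes densities with
respect to `ν` unique almost everywhere. -/
lemma IsDensityFamily.ae_eq_mul [SigmaFinite ν] (hq : IsDensityFamily Θ Q (Q θ) q)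
    (hq' : IsDensityFamily Θ Q ν q') (hθ : θ ∈ Θ) {θ' : EuclideanSpace ℝ (Fin d)} (h : θ' ∈ Θ) :
    ∀ᵐ v ∂ν, q' θ' v = q' θ v * q θ' v := by
  have e : ν.withDensity (fun v => ENNReal.ofReal (q' θ' v)) =
      ν.withDensity ((fun v => ENNReal.ofReal (q' θ v)) * fun v => ENNReal.ofReal (q θ' v)) := by
    rw [withDensity_mul _ (hq'.measurable θ hθ).ennreal_ofReal (hq.measurable θ' h).ennreal_ofReal,
      ← hq'.withDensity_eq θ hθ, ← hq.withDensity_eq θ' h, hq'.withDensity_eq θ' h]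
  rw [withDensity_eq_iff_of_sigmaFinite (hq'.measurable θ' h).ennreal_ofReal.aemeasurable
    ((hq'.measurable θ hθ).ennreal_ofReal.mul (hq.measurable θ' h).ennreal_ofReal).aemeasurable] at e
  filter_upwards [e] with v hv
  rw [Pi.mul_apply, ← ENNReal.ofReal_mul (hq'.nonneg θ hθ v)] at hv
  exact (ENNReal.ofReal_eq_ofReal_iff (hq'.nonneg θ' h v)
    (mul_nonneg (hq'.nonneg θ hθ v) (hq.nonneg θ' h v))).1 hv

lemma IsDensityFamily.ae_iff (hq' : IsDensityFamily Θ Q ν q') (hθ : θ ∈ Θ) {C : V → Prop} :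
    (∀ᵐ v ∂(Q θ), C v) ↔ ∀ᵐ v ∂ν, 0 < q' θ v → C v := by
  rw [hq'.withDensity_eq θ hθ, ae_withDensity_iff (hq'.measurable θ hθ).ennreal_ofReal]
  simp [ENNReal.ofReal_eq_zero]

/-- The score computed from any densities is the uniform score. -/
lemma HasUniformScore.score_ae_eq [SigmaFinite ν] (hs : HasUniformScore Θ Q θ s) (hθ : θ ∈ Θ)
    (hΘ : UniqueDiffWithinAt ℝ Θ θ) (hq' : IsDensityFamily Θ Q ν q')
    (hdiff : HasScoreAt Θ Q q' θ) : score Θ q' θ =ᵐ[Q θ] s := by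
  obtain ⟨-, -, q, ρ, hq, hρ, hqρ⟩ := hs
  -- The exceptional null set in the chain rule depends on `θ'`. A countable dense set of parameters
  -- leaves a single null set and still determines the derivative, since unique differentiability
  -- passes to dense subsets.
  obtain ⟨D, hDΘ, hDc, hDd⟩ :=
    (TopologicalSpace.IsSeparable.of_separableSpace Θ).exists_countable_dense_subset
  have hmul : ∀ᵐ v ∂ν, ∀ θ' ∈ D, q' θ' v = q' θ v * q θ' v :=
    (ae_ball_iff hDc).2 fun θ' h => hq.ae_eq_mul hq' hθ (hDΘ h)
  have hdiff' := (hq'.ae_iff hθ).1 hdiff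
  refine (hq'.ae_iff hθ).2 ?_
  filter_upwards [hmul, hdiff'] with v hv hd hpos
  obtain ⟨h1, hder⟩ := hasFDerivWithinAt_of_uniform hθ hρ hqρ v
  have hL := (hd hpos).hasFDerivWithinAt
  have hR : HasFDerivWithinAt (fun θ' => q' θ' v) (q' θ v • innerSL ℝ (s v)) D θ :=
    ((hder.mono hDΘ).const_mul (q' θ v)).congr hv (by rw [h1, mul_one])
  have hLR := (hΘ.mono_closure hDd).eq (hL.mono hDΘ) hR
  have hlog := (hL.log hpos.ne').fderivWithin hΘ
  rw [score, gradientWithin, hlog, hLR, smul_smul, inv_mul_cancel₀ hpos.ne', one_smul]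
  exact (InnerProductSpace.toDual ℝ _).symm_apply_apply (s v)

/-- By the chain rule the remainder is almost everywhere at most `q'_θ ρ(θ')`, also where `q'_θ =
0`, and `q'_θ` has integral one. -/
lemma HasUniformScore.isRegularAt [SigmaFinite ν] (hs : HasUniformScore Θ Q θ s)
    (hQ : ∀ θ' ∈ Θ, IsProbabilityMeasure (Q θ')) (hθ : θ ∈ Θ)
    (hΘ : UniqueDiffWithinAt ℝ Θ θ) (hq' : IsDensityFamily Θ Q ν q')
    (hdiff : HasScoreAt Θ Q q' θ) : IsRegularAt Θ Q ν q' θ := by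
  have hsc := hs.score_ae_eq hθ hΘ hq' hdiff
  have hQθ := hQ θ hθ
  obtain ⟨hm, ⟨B, hB⟩, q, ρ, hq, hρ, hqρ⟩ := hs
  refine ⟨hdiff, ?_, ?_⟩
  · exact (Integrable.of_bound hm.aestronglyMeasurable B (ae_of_all _ hB)).congr hsc.symm
  · refine IsBigO.trans_isLittleO (IsBigO.of_bound 1 ?_) hρ
    have hsc' := (hq'.ae_iff hθ).1 hsc
    have hint := hq'.integrable hθ
    have hone : ∫ v, q' θ v ∂ν = 1 := by
      have := hq'.integral_eq hθ (fun _ => (1 : ℝ))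
      simpa using this.symm
    filter_upwards [hqρ, self_mem_nhdsWithin] with θ' h hmem
    have hle : ‖∫ v, |q' θ' v - q' θ v - q' θ v * ⟪score Θ q' θ v, θ' - θ⟫| ∂ν‖ ≤
        ∫ v, q' θ v * ρ θ' ∂ν := by
      refine norm_integral_le_of_norm_le (hint.mul_const _) ?_
      filter_upwards [hsc', hq.ae_eq_mul hq' hθ hmem] with v h1 h2
      rw [norm_abs_eq_norm, h2]
      rcases (hq'.nonneg θ hθ v).eq_or_lt with h0 | h0
      · simp [← h0]
      · rw [h1 h0]
        have e : q' θ v * q θ' v - q' θ v - q' θ v * ⟪s v, θ' - θ⟫ =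
            q' θ v * (q θ' v - 1 - ⟪s v, θ' - θ⟫) := by ring
        rw [e, norm_mul, Real.norm_of_nonneg h0.le]
        exact mul_le_mul_of_nonneg_left (h v) h0.le
    rw [integral_mul_const, hone, one_mul] at hle
    rw [one_mul]
    exact hle.trans (le_abs_self _)

/-! ### From the quadratic form to the Fisher information matrix. -/

lemma integrable_mul_score {P : EuclideanSpace ℝ (Fin d) → Measure V}
    {p : EuclideanSpace ℝ (Fin d) → V → ℝ} (h : MemLp (score Θ p θ) 2 (P θ)) (i j : Fin d) :
    Integrable (fun x => score Θ p θ x i * score Θ p θ x j) (P θ) := by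
  have hc : ∀ i, MemLp (fun x => score Θ p θ x i) 2 (P θ) := fun i =>
    (EuclideanSpace.proj (𝕜 := ℝ) i).comp_memLp' h
  exact (hc i).integrable_mul (hc j)

lemma dotProduct_fisherMatrix_mulVec {P : EuclideanSpace ℝ (Fin d) → Measure V}
    {p : EuclideanSpace ℝ (Fin d) → V → ℝ} (h : MemLp (score Θ p θ) 2 (P θ)) (x : Fin d → ℝ) :
    x ⬝ᵥ (fisherMatrix Θ P p θ).mulVec x = ∫ v, ⟪WithLp.toLp 2 x, score Θ p θ v⟫ ^ 2 ∂(P θ) := by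
  have e : ∀ v, ⟪WithLp.toLp 2 x, score Θ p θ v⟫ ^ 2 =
      ∑ i, x i * ∑ j, score Θ p θ v i * score Θ p θ v j * x j := fun v => by
    have : ⟪WithLp.toLp 2 x, score Θ p θ v⟫ = ∑ i, x i * score Θ p θ v i := by
      simp [PiLp.inner_apply, mul_comm]
    rw [this, sq, Finset.sum_mul]
    refine Finset.sum_congr rfl fun i _ => ?_
    rw [Finset.mul_sum, Finset.mul_sum]
    exact Finset.sum_congr rfl fun j _ => by ring
  simp_rw [e]
  rw [integral_finsetSum _ fun i _ => (integrable_finsetSum _ fun j _ =>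
    (integrable_mul_score h i j).mul_const _).const_mul _]
  simp only [dotProduct, Matrix.mulVec, fisherMatrix, Matrix.of_apply]
  refine Finset.sum_congr rfl fun i _ => ?_
  rw [integral_const_mul, integral_finsetSum _ fun j _ => (integrable_mul_score h i j).mul_const _]
  simp_rw [integral_mul_const]

lemma ofReal_dotProduct_fisherMatrix {P : EuclideanSpace ℝ (Fin d) → Measure V}
    {p : EuclideanSpace ℝ (Fin d) → V → ℝ} (h : MemLp (score Θ p θ) 2 (P θ)) (x : Fin d → ℝ) :
    ENNReal.ofReal (x ⬝ᵥ (fisherMatrix Θ P p θ).mulVec x) =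
      fisherForm Θ P p θ (WithLp.toLp 2 x) := by
  rw [dotProduct_fisherMatrix_mulVec h, fisherForm,
    ofReal_integral_eq_lintegral_ofReal _ (ae_of_all _ fun _ => sq_nonneg _)]
  exact (h.const_inner _).integrable_sq

lemma isHermitian_fisherMatrix (P : EuclideanSpace ℝ (Fin d) → Measure V)
    (p : EuclideanSpace ℝ (Fin d) → V → ℝ) : (fisherMatrix Θ P p θ).IsHermitian := by
  ext i j
  simp [fisherMatrix, mul_comm]

end ArbitraryDensities

end LDPFisher

theorem lemma1 {X Z : Type*} [MeasurableSpace X] [MeasurableSpace Z] {d n : ℕ}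
    (ε : ℝ) (hε : 0 ≤ ε)
    -- the parametric family, its densities, and the parameter under consideration
    (Θ : Set (EuclideanSpace ℝ (Fin d)))
    (P : EuclideanSpace ℝ (Fin d) → Measure X)
    (hP : ∀ θ' ∈ Θ, IsProbabilityMeasure (P θ'))
    (μ : Measure X) [SigmaFinite μ]
    (p : EuclideanSpace ℝ (Fin d) → X → ℝ)
    (hp : LDPFisher.IsDensityFamily Θ P μ p)
    (θ : EuclideanSpace ℝ (Fin d)) (hθ : θ ∈ Θ)
    -- gradients along `Θ` at `θ` are unique (automatic at interior points)
    (hΘ : UniqueDiffWithinAt ℝ Θ θ)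
    (hreg : LDPFisher.IsRegularAt Θ P μ p θ)
    -- the sequentially interactive mechanisms
    (K : (i : Fin n) → Kernel (X × (Fin i → Z)) Z) [∀ i, IsMarkovKernel (K i)]
    (hK : ∀ (i : Fin n) (z : Fin i → Z), LDPFisher.IsLDP ε ((K i).sectL z)) :
    -- `Z^n` has densities whose score at `θ` exists
    (∃ (ν : Measure (Fin n → Z)) (q : EuclideanSpace ℝ (Fin d) → (Fin n → Z) → ℝ),
      SigmaFinite ν ∧
      LDPFisher.IsDensityFamily Θ (fun θ' => LDPFisher.outputLaw K (P θ')) ν q ∧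
      LDPFisher.HasScoreAt Θ (fun θ' => LDPFisher.outputLaw K (P θ')) q θ) ∧
    -- and for any such densities the Fisher information of `Z^n` obeys the bound
    ∀ (ν : Measure (Fin n → Z)) (q : EuclideanSpace ℝ (Fin d) → (Fin n → Z) → ℝ),
      SigmaFinite ν →
      LDPFisher.IsDensityFamily Θ (fun θ' => LDPFisher.outputLaw K (P θ')) ν q →
      LDPFisher.HasScoreAt Θ (fun θ' => LDPFisher.outputLaw K (P θ')) q θ →
      LDPFisher.IsRegularAt Θ (fun θ' => LDPFisher.outputLaw K (P θ')) ν q θ ∧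
      (∀ u : EuclideanSpace ℝ (Fin d),
        LDPFisher.fisherForm Θ (fun θ' => LDPFisher.outputLaw K (P θ')) q θ u ≤
          ENNReal.ofReal (n * LDPFisher.Upsilon ε) * LDPFisher.fisherForm Θ P p θ u) ∧
      (MemLp (LDPFisher.score Θ p θ) 2 (P θ) →
        MemLp (LDPFisher.score Θ q θ) 2 (LDPFisher.outputLaw K (P θ)) ∧
        ((n * LDPFisher.Upsilon ε) • LDPFisher.fisherMatrix Θ P p θ -
          LDPFisher.fisherMatrix Θ (fun θ' => LDPFisher.outputLaw K (P θ')) q θ).PosSemidef) := by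
  have hprob : ∀ θ' ∈ Θ, IsProbabilityMeasure (LDPFisher.outputLaw K (P θ')) := fun θ' h => by
    have := hP θ' h
    infer_instance
  have hQθ := hprob θ hθ
  obtain ⟨s, hs, hI⟩ := LDPFisher.exists_hasUniformScore_outputLaw hP hp hθ hΘ hreg K hK
  refine ⟨?_, fun ν q hν hq hdiff => ?_⟩
  -- The law at `θ` itself serves as dominating measure.
  · obtain ⟨-, -, q, ρ, hq, hρ, hqρ⟩ := hs
    exact ⟨_, q, inferInstance, hq, ae_of_all _ fun v =>
      (LDPFisher.hasFDerivWithinAt_of_uniform hθ hρ hqρ v).2.differentiableWithinAt⟩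
  have hsc := hs.score_ae_eq hθ hΘ hq hdiff
  have hform : ∀ u : EuclideanSpace ℝ (Fin d),
      LDPFisher.fisherForm Θ (fun θ' => LDPFisher.outputLaw K (P θ')) q θ u ≤
        ENNReal.ofReal (n * LDPFisher.Upsilon ε) * LDPFisher.fisherForm Θ P p θ u := fun u => by
    refine (lintegral_congr_ae ?_).trans_le (hI u)
    filter_upwards [hsc] with v hv
    rw [hv]
  refine ⟨hs.isRegularAt hprob hθ hΘ hq hdiff, hform, fun hL2 => ?_⟩
  -- The output score agrees almost surely with a bounded function.
  have hL2' : MemLp (LDPFisher.score Θ q θ) 2 (LDPFisher.outputLaw K (P θ)) := by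
    obtain ⟨B, hB⟩ := hs.bounded
    exact (MemLp.of_bound hs.measurable.aestronglyMeasurable B (ae_of_all _ hB)).ae_eq hsc.symm
  have hc0 : 0 ≤ n * LDPFisher.Upsilon ε := mul_nonneg n.cast_nonneg (LDPFisher.Upsilon_nonneg ε)
  refine ⟨hL2', Matrix.PosSemidef.of_dotProduct_mulVec_nonneg ?_ fun x => ?_⟩
  · refine Matrix.IsHermitian.sub ?_ (LDPFisher.isHermitian_fisherMatrix _ _)
    rw [Matrix.IsHermitian, Matrix.conjTranspose_smul, LDPFisher.isHermitian_fisherMatrix]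
    simp
  -- Both scores are square integrable, so the bound in `[0, ∞]` becomes a real inequality between
  -- the quadratic forms of the matrices.
  · have h := hform (WithLp.toLp 2 x)
    rw [← LDPFisher.ofReal_dotProduct_fisherMatrix hL2,
      ← LDPFisher.ofReal_dotProduct_fisherMatrix (P := fun θ' => LDPFisher.outputLaw K (P θ')) hL2',
      ← ENNReal.ofReal_mul hc0, ENNReal.ofReal_le_ofReal_iff (mul_nonneg hc0 ?_)] at h
    · rw [star_trivial, Matrix.sub_mulVec, Matrix.smul_mulVec, dotProduct_sub, dotProduct_smul,
        smul_eq_mul]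
      exact sub_nonneg.2 h
    · rw [LDPFisher.dotProduct_fisherMatrix_mulVec hL2]
      exact integral_nonneg fun _ => sq_nonneg _
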